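/- Let $n\ge 2$ and $m\ge 0$ be integers and let $c\in\mathbb R$. Let $N$ be a smooth Riemannian manifold of dimension $n+m$ with constant sectional curvature $c$, let $M$ be a smooth Riemannian manifold of dimension $n$, and let $f\colon M\to N$ be a smooth isometric immersion. Fix $x\in M$, an orthonormal basis $e_1,\dots,e_n$ of $T_xM$ and an orthonormal basis $\xi_1,\dots,\xi_m$ of the normal space of the immersion at $x$. Let $R$ be the curvature tensor of $M$, with the sign convention for which $R(e_i,e_j,e_j,e_i)$ is the sectional curvature of the plane spanned by $e_i,e_j$; let $R^\perp$ be the curvature tensor of the normal connection $\nabla^\perp$ (the normal part of the Levi-Civita connection of $N$ along $f$); let $h$ be the second fundamental form, and let $H=\frac1n\sum_{i=1}^n h(e_i,e_i)$ be the mean curvature vector. Define at $x$ the normalized scalar curvature and the normal scalar curvature $$\rho=\frac{2}{n(n-1)}\sum_{1\le i<j\le n}R(e_i,e_j,e_j,e_i),\qquad \rho^\perp=\frac{2}{n(n-1)}\Bigl(\sum_{1\le i<j\le n}\ \sum_{1\le r<s\le m}\langle R^\perp(e_i,e_j)\xi_r,\xi_s\rangle^2\Bigr)^{1/2}.$$ Then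 $$\rho+\rho^\perp\le |H|^2+c .$$ -/

import Mathlib

open scoped Manifold ContDiff

noncomputable section

namespace SubmanifoldGeometry

/-! ### Riemannian geometry in an open set of a vector space

`G y` is the inner product at the point `y`; vector fields are maps `E → E`, and vector fields
along `F : E → E'` are maps `E → E'`. -/

section Coordinates

variable {E E' : Type*} [NormedAddCommGroup E] [NormedSpace ℝ E]
  [NormedAddCommGroup E'] [NormedSpace ℝ E']

/-- The Christoffel symbols of the metric `G`: `christoffel G y u v` is the vector `z` with
`G y z w = (D_u G (v, w) + D_v G (u, w) - D_w G (u, v)) / 2` for all `w`. -/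
def christoffel (G : E → E →L[ℝ] E →L[ℝ] ℝ) (y u v : E) : E :=
  (G y).inverse ((1 / 2 : ℝ) •
    (fderiv ℝ G y u v + fderiv ℝ G y v u - ((fderiv ℝ G y).flip u).flip v))

/-- The covariant derivative `∇_X V` of a vector field `V` along `F`, for the pull-back by `F` of
the Levi-Civita connection of the metric `G'`. -/
def covDerivAlong (G' : E' → E' →L[ℝ] E' →L[ℝ] ℝ) (F : E → E') (X : E → E) (V : E → E') :
    E → E' :=
  fun y => fderiv ℝ V y (X y) + christoffel G' (F y) (fderiv ℝ F y (X y)) (V y)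

/-- The Levi-Civita covariant derivative `∇_X Y` of the metric `G`. -/
def covDeriv (G : E → E →L[ℝ] E →L[ℝ] ℝ) (X Y : E → E) : E → E :=
  fun y => fderiv ℝ Y y (X y) + christoffel G y (X y) (Y y)

/-- `R(X, Y) Z = ∇_X ∇_Y Z - ∇_Y ∇_X Z - ∇_[X, Y] Z` for the Levi-Civita connection of `G`. -/
def curvature (G : E → E →L[ℝ] E →L[ℝ] ℝ) (X Y Z : E → E) : E → E :=
  fun y => covDeriv G X (covDeriv G Y Z) y - covDeriv G Y (covDeriv G X Z) y
    - covDeriv G (VectorField.lieBracket ℝ X Y) Z y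

/-- The metric induced by the metric `G'` through the map `F`. -/
def inducedMetric (G' : E' → E' →L[ℝ] E' →L[ℝ] ℝ) (F : E → E') : E → E →L[ℝ] E →L[ℝ] ℝ :=
  fun y => (G' (F y)).bilinearComp (fderiv ℝ F y) (fderiv ℝ F y)

/-- The component normal to the immersion `F` of a vector `w` at the point `F y`. The vector
subtracted is the orthogonal projection of `w` to the range of the differential of `F`, that is
`fderiv ℝ F y z`, where `G' (F y) (fderiv ℝ F y z) (fderiv ℝ F y v) = G' (F y) w (fderiv ℝ F y v)`
for all `v`. -/
def normalPart (G' : E' → E' →L[ℝ] E' →L[ℝ] ℝ) (F : E → E') (y : E) (w : E') : E' :=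
  w - fderiv ℝ F y ((inducedMetric G' F y).inverse ((G' (F y) w).comp (fderiv ℝ F y)))

/-- The second fundamental form `h(X, Y)`, the normal part of `∇_X (F_* Y)`. -/
def secondFundForm (G' : E' → E' →L[ℝ] E' →L[ℝ] ℝ) (F : E → E') (X Y : E → E) : E → E' :=
  fun y => normalPart G' F y (covDerivAlong G' F X (fun z => fderiv ℝ F z (Y z)) y)

/-- The normal connection `∇^⊥_X V`, the normal part of `∇_X V`. -/
def normalCovDeriv (G' : E' → E' →L[ℝ] E' →L[ℝ] ℝ) (F : E → E') (X : E → E) (V : E → E') :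
    E → E' :=
  fun y => normalPart G' F y (covDerivAlong G' F X V y)

/-- `R^⊥(X, Y) V = ∇^⊥_X ∇^⊥_Y V - ∇^⊥_Y ∇^⊥_X V - ∇^⊥_[X, Y] V`, for a normal vector field `V`
along `F`. -/
def normalCurvature (G' : E' → E' →L[ℝ] E' →L[ℝ] ℝ) (F : E → E') (X Y : E → E) (V : E → E') :
    E → E' :=
  fun y => normalCovDeriv G' F X (normalCovDeriv G' F Y V) y
    - normalCovDeriv G' F Y (normalCovDeriv G' F X V) y
    - normalCovDeriv G' F (VectorField.lieBracket ℝ X Y) V y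

end Coordinates

/-! ### Riemannian manifolds -/

/-- A smooth Riemannian metric on a `d`-dimensional smooth manifold. -/
abbrev Metric (d : ℕ) (M : Type*) [TopologicalSpace M]
    [ChartedSpace (EuclideanSpace ℝ (Fin d)) M] [IsManifold (𝓡 d) ∞ M] :=
  Bundle.ContMDiffRiemannianMetric (𝓡 d) ∞ (EuclideanSpace ℝ (Fin d))
    (fun x : M => TangentSpace (𝓡 d) x)

section Manifold

variable {d : ℕ} {M : Type*} [TopologicalSpace M] [ChartedSpace (EuclideanSpace ℝ (Fin d)) M]
  [IsManifold (𝓡 d) ∞ M]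

variable (d) in
/-- The coordinates of a tangent vector at `x` in the preferred chart at `x`. -/
def coord (x : M) (u : TangentSpace (𝓡 d) x) : EuclideanSpace ℝ (Fin d) :=
  mfderiv (𝓡 d) 𝓘(ℝ, EuclideanSpace ℝ (Fin d)) (extChartAt (𝓡 d) x) x u

variable (d) in
/-- The differential at `y` of the inverse of the preferred chart at `x`. -/
def chartInvDeriv (x : M) (y : EuclideanSpace ℝ (Fin d)) :
    EuclideanSpace ℝ (Fin d) →L[ℝ] TangentSpace (𝓡 d) ((extChartAt (𝓡 d) x).symm y) :=
  mfderiv 𝓘(ℝ, EuclideanSpace ℝ (Fin d)) (𝓡 d) (extChartAt (𝓡 d) x).symm y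

/-- The metric `g` read in the preferred chart at `x`. -/
def metricInChart (g : Metric d M) (x : M) (y : EuclideanSpace ℝ (Fin d)) :
    EuclideanSpace ℝ (Fin d) →L[ℝ] EuclideanSpace ℝ (Fin d) →L[ℝ] ℝ :=
  ContinuousLinearMap.bilinearComp
    (E := EuclideanSpace ℝ (Fin d)) (F := EuclideanSpace ℝ (Fin d))
    (g.inner ((extChartAt (𝓡 d) x).symm y)) (chartInvDeriv d x y) (chartInvDeriv d x y)

/-- The Riemann curvature tensor `R(u, v, w, z) = ⟨R(u, v) w, z⟩` at `x`, computed in the preferred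
chart at `x` with `u`, `v`, `w` extended to fields with constant coordinates. -/
def riemannTensor (g : Metric d M) (x : M) (u v w z : TangentSpace (𝓡 d) x) : ℝ :=
  metricInChart g x (extChartAt (𝓡 d) x x)
    (curvature (metricInChart g x) (fun _ => coord d x u) (fun _ => coord d x v)
      (fun _ => coord d x w) (extChartAt (𝓡 d) x x))
    (coord d x z)

/-- The sectional curvature of the plane spanned by linearly independent `u`, `v`. -/
def sectionalCurvature (g : Metric d M) (x : M) (u v : TangentSpace (𝓡 d) x) : ℝ :=
  riemannTensor g x u v v u / (g.inner x u u * g.inner x v v - g.inner x u v ^ 2)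

/-- All sectional curvatures are equal to `c`. -/
def HasConstantSectionalCurvature (g : Metric d M) (c : ℝ) : Prop :=
  ∀ (x : M) (u v : TangentSpace (𝓡 d) x), LinearIndependent ℝ ![u, v] →
    sectionalCurvature g x u v = c

/-- Orthonormality of tangent vectors at `x`. -/
def IsOrthonormal (g : Metric d M) (x : M) {k : ℕ} (v : Fin k → TangentSpace (𝓡 d) x) : Prop :=
  ∀ i j, g.inner x (v i) (v j) = if i = j then 1 else 0

/-- The normalized scalar curvature
`ρ = 2 / (d (d - 1)) * ∑_{i < j} R(e_i, e_j, e_j, e_i)`, for an orthonormal basis `e` of the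
tangent space at `x`. -/
def normalizedScalarCurvature (g : Metric d M) (x : M) (e : Fin d → TangentSpace (𝓡 d) x) : ℝ :=
  2 / ((d : ℝ) * ((d : ℝ) - 1)) *
    ∑ i, ∑ j ∈ Finset.Ioi i, riemannTensor g x (e i) (e j) (e j) (e i)

end Manifold

/-! ### Isometric immersions -/

section Immersion

variable {n d : ℕ}
  {M : Type*} [TopologicalSpace M] [ChartedSpace (EuclideanSpace ℝ (Fin n)) M]
  [IsManifold (𝓡 n) ∞ M]
  {N : Type*} [TopologicalSpace N] [ChartedSpace (EuclideanSpace ℝ (Fin d)) N]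
  [IsManifold (𝓡 d) ∞ N]

/-- A smooth map whose differential preserves inner products (hence is injective). -/
def IsIsometricImmersion (gM : Metric n M) (gN : Metric d N) (f : M → N) : Prop :=
  ContMDiff (𝓡 n) (𝓡 d) ∞ f ∧
    ∀ (x : M) (u v : TangentSpace (𝓡 n) x),
      gN.inner (f x) (mfderiv (𝓡 n) (𝓡 d) f x u) (mfderiv (𝓡 n) (𝓡 d) f x v) = gM.inner x u v

/-- The vector `ξ` at `f x` is normal to the immersion `f` at `x`. -/
def IsNormal (gN : Metric d N) (f : M → N) (x : M) (ξ : TangentSpace (𝓡 d) (f x)) : Prop :=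
  ∀ u : TangentSpace (𝓡 n) x, gN.inner (f x) ξ (mfderiv (𝓡 n) (𝓡 d) f x u) = 0

/-- The second fundamental form `h(u, v)` of the immersion `f` at `x`, computed in the preferred
charts at `x` and `f x`. -/
def secondFundamentalForm (gN : Metric d N) (f : M → N) (x : M) (u v : TangentSpace (𝓡 n) x) :
    EuclideanSpace ℝ (Fin d) :=
  secondFundForm (metricInChart gN (f x)) (writtenInExtChartAt (𝓡 n) (𝓡 d) x f)
    (fun _ => coord n x u) (fun _ => coord n x v) (extChartAt (𝓡 n) x x)

/-- The mean curvature vector `H = (1 / n) * trace h` at `x`, in the coordinates of the preferred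
chart at `f x`; `e` is an orthonormal basis of the tangent space at `x`. -/
def meanCurvature (gN : Metric d N) (f : M → N) (x : M) (e : Fin n → TangentSpace (𝓡 n) x) :
    EuclideanSpace ℝ (Fin d) :=
  (1 / (n : ℝ)) • ∑ i, secondFundamentalForm gN f x (e i) (e i)

/-- `|H|²`. -/
def meanCurvatureNormSq (gN : Metric d N) (f : M → N) (x : M)
    (e : Fin n → TangentSpace (𝓡 n) x) : ℝ :=
  metricInChart gN (f x) (extChartAt (𝓡 d) (f x) (f x))
    (meanCurvature gN f x e) (meanCurvature gN f x e)

/-- `⟨R^⊥(u, v) ξ, η⟩` at `x` for normal vectors `ξ`, `η`, computed in the preferred charts at `x`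
and `f x`. The vectors `u`, `v` are extended to fields with constant coordinates, and `ξ` to the
normal field whose value at each point is the normal part of the vector with the coordinates of
`ξ`; the curvature being a tensor, the extensions do not matter. -/
def normalCurvatureTensor (gN : Metric d N) (f : M → N) (x : M) (u v : TangentSpace (𝓡 n) x)
    (ξ η : TangentSpace (𝓡 d) (f x)) : ℝ :=
  metricInChart gN (f x) (extChartAt (𝓡 d) (f x) (f x))
    (normalCurvature (metricInChart gN (f x)) (writtenInExtChartAt (𝓡 n) (𝓡 d) x f)
      (fun _ => coord n x u) (fun _ => coord n x v)
      (fun y => normalPart (metricInChart gN (f x)) (writtenInExtChartAt (𝓡 n) (𝓡 d) x f) y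
        (coord d (f x) ξ))
      (extChartAt (𝓡 n) x x))
    (coord d (f x) η)

/-- The normal scalar curvature
`ρ^⊥ = 2 / (n (n - 1)) * (∑_{i < j} ∑_{r < s} ⟨R^⊥(e_i, e_j) ξ_r, ξ_s⟩²) ^ (1 / 2)`, for
orthonormal bases `e` of the tangent space and `ξ` of the normal space at `x`. -/
def normalScalarCurvature (gN : Metric d N) (f : M → N) (x : M)
    (e : Fin n → TangentSpace (𝓡 n) x) {m : ℕ} (ξ : Fin m → TangentSpace (𝓡 d) (f x)) : ℝ :=
  2 / ((n : ℝ) * ((n : ℝ) - 1)) *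
    Real.sqrt (∑ i, ∑ j ∈ Finset.Ioi i, ∑ r, ∑ s ∈ Finset.Ioi r,
      normalCurvatureTensor gN f x (e i) (e j) (ξ r) (ξ s) ^ 2)

end Immersion

end SubmanifoldGeometry

end

/-! Let `A r` be the matrix of the shape operator in the direction `ξ r`. The Gauss equation
expresses the sectional curvatures of `M` by `c` and the 2×2 minors of the `A r`. Since the ambient
curvature is constant, the Ricci equation has no ambient term and identifies `R^⊥` with the
commutators of the `A r`. The scalar parts of the `A r` do not affect the commutators and carry
`|H|²`, so the theorem becomes an inequality on symmetric matrices, `commSq_le_normSq_sq`: the sum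
of all `|[A r, A s]|²` is at most `(∑ |A r|²)²`.

Both sides of this inequality are homogeneous of degree four, so a maximizer `B` of the left side
exists among symmetric families with `∑ |B a|² = 1`; let `q` be the maximum. Choose a unit vector
`v` for which `X = ∑ v a • B a` has the largest norm. Moving `B a` to `B a + s v a X` and comparing
first order terms at `s = 0` gives `q |X|² = ∑ |[X, B b]|²`. It remains to bound the right side by
`|X|² ∑ |B b|²` (`sum_frob_comm_le`), whence `q ≤ 1`.

For that bound diagonalize `X` with eigenvalues `η`, put `G = ∑ η i ^ 2 = |X|²` and `b i j = ∑ (B a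
i j)²`. The sum to be bounded is `∑ (η i - η j)² b i j`, and only pairs with `(η i - η j)² > G` do
harm. Such pairs, oriented by the sign of the gap, all share their first or all share their second
index, and their total excess over `G` is at most `G` (`sum_large_gaps_le`). The choice of `v` gives
`2 b i j ≤ G` off the diagonal, so the harm is at most `G²`. It is repaid by the diagonal, which
contributes nothing to the commutators although `∑ b i i ≥ G`.

The geometric half works in charts: `IsImmersionAt.gauss` and `IsImmersionAt.ricci` are proved for
maps between vector spaces with variable metrics, and `IsMetricAt.curvatureAt_eq_of_constant` gives
the ambient curvature tensor. -/

namespace SubmanifoldGeometry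

/-! ### Eigenvalue gaps and the commutators with one extremal matrix. -/

section MatrixInequality

variable {ι α : Type*} [Fintype ι] [Fintype α]

/-- The Frobenius inner product of real matrices. -/
def frob (A B : Matrix ι ι ℝ) : ℝ := ∑ i, ∑ j, A i j * B i j

theorem frob_comm (A B : Matrix ι ι ℝ) : frob A B = frob B A := by
  simp only [frob, mul_comm]

theorem frob_self_nonneg (A : Matrix ι ι ℝ) : 0 ≤ frob A A :=
  Finset.sum_nonneg fun _ _ => Finset.sum_nonneg fun _ _ => mul_self_nonneg _

theorem frob_add_left (A B C : Matrix ι ι ℝ) : frob (A + B) C = frob A C + frob B C := by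
  simp [frob, add_mul, Finset.sum_add_distrib]

theorem frob_smul_left (s : ℝ) (A C : Matrix ι ι ℝ) : frob (s • A) C = s * frob A C := by
  simp [frob, Finset.mul_sum, mul_assoc]

theorem frob_add_right (A B C : Matrix ι ι ℝ) : frob C (A + B) = frob C A + frob C B := by
  rw [frob_comm, frob_add_left, frob_comm A, frob_comm B]

theorem frob_smul_right (s : ℝ) (A C : Matrix ι ι ℝ) : frob C (s • A) = s * frob C A := by
  rw [frob_comm, frob_smul_left, frob_comm]

theorem frob_sum_left (A : α → Matrix ι ι ℝ) (C : Matrix ι ι ℝ) :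
    frob (∑ a, A a) C = ∑ a, frob (A a) C := by
  simp only [frob, Matrix.sum_apply, Finset.sum_mul]
  rw [Finset.sum_comm]
  refine Eq.trans ?_ Finset.sum_comm
  rw [Finset.sum_comm]
  exact Finset.sum_congr rfl fun i _ => Finset.sum_comm

theorem frob_eq_trace (A B : Matrix ι ι ℝ) : frob A B = Matrix.trace (A.transpose * B) := by
  simp only [frob, Matrix.trace, Matrix.diag, Matrix.mul_apply, Matrix.transpose_apply]
  exact Finset.sum_comm

/-- With `k = J.card` and `S = ∑ j ∈ J, η j`, the bounds `η i₀ ^ 2 + ∑ j ∈ J, η j ^ 2 ≤ G` and `S² ≤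
k ∑ j ∈ J, η j ^ 2` reduce the claim to `0 ≤ (η i₀ + S)²`. -/
theorem sum_star_sub_le [DecidableEq ι] (η : ι → ℝ) (i₀ : ι) (J : Finset ι) (h : i₀ ∉ J) :
    ∑ j ∈ J, ((η i₀ - η j) ^ 2 - ∑ i, η i ^ 2) ≤ ∑ i, η i ^ 2 := by
  have hG : ∑ i ∈ insert i₀ J, η i ^ 2 ≤ ∑ i, η i ^ 2 :=
    Finset.sum_le_univ_sum_of_nonneg fun i => sq_nonneg _
  rw [Finset.sum_insert h] at hG
  set G := ∑ i, η i ^ 2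
  have hcs : (∑ j ∈ J, η j) ^ 2 ≤ (J.card : ℝ) * ∑ j ∈ J, η j ^ 2 := sq_sum_le_card_mul_sum_sq
  have hexp : ∑ j ∈ J, ((η i₀ - η j) ^ 2 - G) =
      J.card * η i₀ ^ 2 - 2 * η i₀ * ∑ j ∈ J, η j + ∑ j ∈ J, η j ^ 2 - J.card * G := by
    simp only [sub_sq, Finset.sum_sub_distrib, Finset.sum_add_distrib, Finset.sum_const,
      nsmul_eq_mul, Finset.mul_sum]
  rw [hexp]
  have hk : (0 : ℝ) ≤ J.card := Nat.cast_nonneg _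
  nlinarith [mul_le_mul_of_nonneg_left hG hk, sq_nonneg (η i₀ + ∑ j ∈ J, η j)]

/-- Two disjoint pairs have squared gaps of sum at most `2 ∑ η a ^ 2`, so both cannot be large. If
the pairs are chained (`i = l` or `j = k`), the two positive gaps add up to one gap whose square
would exceed `2 ∑ η a ^ 2`, which is impossible for two entries. -/
theorem large_gaps_share [DecidableEq ι] (η : ι → ℝ) {i j k l : ι}
    (hij : 0 < η i - η j) (hij' : ∑ a, η a ^ 2 < (η i - η j) ^ 2)
    (hkl : 0 < η k - η l) (hkl' : ∑ a, η a ^ 2 < (η k - η l) ^ 2) : i = k ∨ j = l := by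
  by_contra! hne
  obtain ⟨hik, hjl⟩ := hne
  have two : ∀ a b : ι, a ≠ b → η a ^ 2 + η b ^ 2 ≤ ∑ a, η a ^ 2 := fun a b hab => by
    have := Finset.sum_le_univ_sum_of_nonneg (s := {a, b}) (fun i => sq_nonneg (η i))
    rwa [Finset.sum_pair hab] at this
  have hij_ne : i ≠ j := by rintro rfl; simp at hij
  have hkl_ne : k ≠ l := by rintro rfl; simp at hkl
  by_cases hil : i = l
  · subst hil
    have hkj : k ≠ j := by rintro rfl; linarith
    nlinarith [two k j hkj, mul_pos hij hkl, sq_nonneg (η k + η j)]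
  by_cases hjk : j = k
  · subst hjk
    nlinarith [two i l hil, mul_pos hij hkl, sq_nonneg (η i + η l)]
  have four := Finset.sum_le_univ_sum_of_nonneg (s := {i, j, k, l}) (fun i => sq_nonneg (η i))
  rw [Finset.sum_insert (by simp [hij_ne, hik, hil]), Finset.sum_insert (by simp [hjk, hjl]),
    Finset.sum_pair hkl_ne] at four
  nlinarith [sq_nonneg (η i + η j), sq_nonneg (η k + η l)]

theorem sum_large_gaps_le [DecidableEq ι] (η : ι → ℝ) :
    ∑ p : ι × ι with 0 < η p.1 - η p.2 ∧ ∑ a, η a ^ 2 < (η p.1 - η p.2) ^ 2,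
      ((η p.1 - η p.2) ^ 2 - ∑ a, η a ^ 2) ≤ ∑ a, η a ^ 2 := by
  set P : Finset (ι × ι) :=
    {p : ι × ι | 0 < η p.1 - η p.2 ∧ ∑ a, η a ^ 2 < (η p.1 - η p.2) ^ 2} with hP
  have hmem : ∀ p ∈ P, 0 < η p.1 - η p.2 ∧ ∑ a, η a ^ 2 < (η p.1 - η p.2) ^ 2 := by
    intro p hp; simpa [hP] using hp
  have hshare : ∀ p ∈ P, ∀ q ∈ P, p.1 = q.1 ∨ p.2 = q.2 := fun p hp q hq =>
    large_gaps_share η (hmem p hp).1 (hmem p hp).2 (hmem q hq).1 (hmem q hq).2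
  rcases P.eq_empty_or_nonempty with h0 | ⟨p₀, hp₀⟩
  · rw [h0, Finset.sum_empty]; positivity
  -- Pairwise sharing forces a star: a pair leaving the row of `p₀` and a pair leaving its column
  -- would share nothing with each other.
  have hrow : (∀ p ∈ P, p.1 = p₀.1) ∨ (∀ p ∈ P, p.2 = p₀.2) := by
    by_contra! hcon
    obtain ⟨⟨p, hp, hp1⟩, ⟨q, hq, hq2⟩⟩ := hcon
    have h1 := (hshare p hp p₀ hp₀).resolve_left hp1
    have h2 := (hshare q hq p₀ hp₀).resolve_right hq2
    rcases hshare p hp q hq with h | h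
    · exact hp1 (h.trans h2)
    · exact hq2 (h.symm.trans h1)
  rcases hrow with hr | hr
  · have hinj : Set.InjOn Prod.snd (P : Set (ι × ι)) := fun p hp q hq hpq =>
      Prod.ext ((hr p hp).trans (hr q hq).symm) hpq
    have hnot : p₀.1 ∉ P.image Prod.snd := by
      intro hc
      obtain ⟨p, hp, hpe⟩ := Finset.mem_image.1 hc
      have := (hmem p hp).1
      rw [hpe, hr p hp, sub_self] at this
      exact lt_irrefl _ this
    have := sum_star_sub_le η p₀.1 (P.image Prod.snd) hnot
    rw [Finset.sum_image hinj] at this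
    refine le_trans (le_of_eq (Finset.sum_congr rfl fun p hp => ?_)) this
    rw [hr p hp]
  · have hinj : Set.InjOn Prod.fst (P : Set (ι × ι)) := fun p hp q hq hpq =>
      Prod.ext hpq ((hr p hp).trans (hr q hq).symm)
    have hnot : p₀.2 ∉ P.image Prod.fst := by
      intro hc
      obtain ⟨p, hp, hpe⟩ := Finset.mem_image.1 hc
      have := (hmem p hp).1
      rw [hpe, hr p hp, sub_self] at this
      exact lt_irrefl _ this
    have := sum_star_sub_le η p₀.2 (P.image Prod.fst) hnot
    rw [Finset.sum_image hinj] at this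
    refine le_trans (le_of_eq (Finset.sum_congr rfl fun p hp => ?_)) this
    rw [hr p hp]
    ring

/-- Each squared gap is replaced by `G` plus its excess. The diagonal terms vanish, hence `- ∑ i, b
i i`. The excesses sum to at most `G` in each orientation and have weights at most `B / 2`, hence `+
B`. -/
theorem sum_gap_sq_mul_le [DecidableEq ι] (η : ι → ℝ) (b : ι → ι → ℝ) {B : ℝ}
    (hb : ∀ i j, 0 ≤ b i j) (hsymm : ∀ i j, b i j = b j i) (hB : 0 ≤ B)
    (hbB : ∀ i j, i ≠ j → 2 * b i j ≤ B) :
    ∑ i, ∑ j, (η i - η j) ^ 2 * b i j ≤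
      (∑ i, η i ^ 2) * (∑ i, ∑ j, b i j - ∑ i, b i i + B) := by
  set G := ∑ i, η i ^ 2 with hG
  have hG0 : 0 ≤ G := by positivity
  set P : Finset (ι × ι) := {p : ι × ι | 0 < η p.1 - η p.2 ∧ G < (η p.1 - η p.2) ^ 2} with hP
  have hsum := sum_large_gaps_le η
  rw [← hG, ← hP] at hsum
  -- The weighted excess is recorded for the positive orientation only; `φ p.swap` supplies the
  -- other one.
  set φ : ι × ι → ℝ := fun p =>
    if 0 < η p.1 - η p.2 ∧ G < (η p.1 - η p.2) ^ 2 then ((η p.1 - η p.2) ^ 2 - G) * b p.1 p.2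
    else 0 with hφ
  have hφsum : ∑ p, φ p ≤ G * B / 2 := by
    rw [hφ, ← Finset.sum_filter, ← hP]
    calc ∑ p ∈ P, ((η p.1 - η p.2) ^ 2 - G) * b p.1 p.2
        ≤ ∑ p ∈ P, ((η p.1 - η p.2) ^ 2 - G) * (B / 2) := by
          refine Finset.sum_le_sum fun p hp => ?_
          have hp' : 0 < η p.1 - η p.2 ∧ G < (η p.1 - η p.2) ^ 2 := by simpa [hP] using hp
          have hne : p.1 ≠ p.2 := fun h => by simp [h] at hp'
          exact mul_le_mul_of_nonneg_left (by linarith [hbB _ _ hne]) (by linarith [hp'.2])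
      _ ≤ G * B / 2 := by
          rw [← Finset.sum_mul, mul_div_assoc]
          exact mul_le_mul_of_nonneg_right hsum (by linarith)
  have hswap : ∑ p : ι × ι, φ p.swap = ∑ p, φ p := Equiv.sum_comp (Equiv.prodComm ι ι) φ
  have hpt : ∀ p : ι × ι, (η p.1 - η p.2) ^ 2 * b p.1 p.2 ≤
      G * b p.1 p.2 - (if p.1 = p.2 then G * b p.1 p.1 else 0) + φ p + φ p.swap := by
    rintro ⟨i, j⟩
    simp only [hφ, Prod.swap]
    by_cases hij : i = j
    · subst hij
      simp
    rw [if_neg hij, hsymm j i, show (η j - η i) ^ 2 = (η i - η j) ^ 2 by ring]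
    have h0 := hb i j
    rcases lt_or_ge G ((η i - η j) ^ 2) with h1 | h1
    · simp only [h1, and_true]
      rcases lt_trichotomy (η i - η j) 0 with h2 | h2 | h2
      · rw [if_neg (by linarith), if_pos (by linarith)]; linarith
      · rw [h2] at h1; norm_num at h1; linarith
      · rw [if_pos (by linarith), if_neg (by linarith)]; linarith
    · simp only [not_lt.2 h1, and_false, if_false]
      nlinarith
  have htot := Finset.sum_le_sum fun p (_ : p ∈ Finset.univ) => hpt p
  rw [Finset.sum_add_distrib, Finset.sum_add_distrib, Finset.sum_sub_distrib, hswap] at htot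
  simp only [Fintype.sum_prod_type, Finset.sum_ite_eq, Finset.mem_univ, if_true,
    ← Finset.mul_sum] at htot hφsum
  nlinarith

theorem exists_orthogonal_diagonalization [DecidableEq ι] (X : Matrix ι ι ℝ)
    (hX : X.transpose = X) :
    ∃ (U : Matrix ι ι ℝ) (η : ι → ℝ), U * U.transpose = 1 ∧
      U.transpose * X * U = Matrix.diagonal η := by
  have hH : X.IsHermitian := by
    rw [Matrix.IsHermitian, Matrix.conjTranspose_eq_transpose_of_trivial, hX]
  refine ⟨(hH.eigenvectorUnitary : Matrix ι ι ℝ), hH.eigenvalues, ?_, ?_⟩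
  · have := Matrix.mem_unitaryGroup_iff.1 hH.eigenvectorUnitary.2
    rwa [Matrix.star_eq_conjTranspose, Matrix.conjTranspose_eq_transpose_of_trivial] at this
  · have := hH.conjStarAlgAut_star_eigenvectorUnitary
    rw [Unitary.conjStarAlgAut_star_apply, Matrix.star_eq_conjTranspose,
      Matrix.conjTranspose_eq_transpose_of_trivial] at this
    simpa using this

theorem frob_conj [DecidableEq ι] (U A B : Matrix ι ι ℝ) (hU : U * U.transpose = 1) :
    frob (U.transpose * A * U) (U.transpose * B * U) = frob A B := by
  rw [frob_eq_trace, frob_eq_trace]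
  have : (U.transpose * A * U).transpose * (U.transpose * B * U) =
      U.transpose * (A.transpose * (U * U.transpose) * B * U) := by
    simp only [Matrix.transpose_mul, Matrix.transpose_transpose, Matrix.mul_assoc]
  rw [this, hU, Matrix.trace_mul_comm, Matrix.mul_one, Matrix.mul_assoc, hU, Matrix.mul_one]

/-- The commutator of two matrices. -/
def matComm (A B : Matrix ι ι ℝ) : Matrix ι ι ℝ := A * B - B * A

theorem matComm_conj [DecidableEq ι] (U A B : Matrix ι ι ℝ) (hU : U * U.transpose = 1) :
    matComm (U.transpose * A * U) (U.transpose * B * U) = U.transpose * matComm A B * U := by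
  have h : ∀ A B : Matrix ι ι ℝ, (U.transpose * A * U) * (U.transpose * B * U) =
      U.transpose * (A * B) * U := fun A B => by
    calc (U.transpose * A * U) * (U.transpose * B * U)
        = U.transpose * A * (U * U.transpose) * B * U := by simp only [Matrix.mul_assoc]
      _ = U.transpose * (A * B) * U := by rw [hU]; simp only [Matrix.mul_assoc, Matrix.one_mul]
  rw [matComm, matComm, h, h, Matrix.mul_sub, Matrix.sub_mul]

/-- The hypothesis `hmax` makes `v` a top eigenvector of the Gram matrix of the family. In an
eigenbasis of `X = ∑ v a • A a` it yields the off-diagonal weight bound needed in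
`sum_gap_sq_mul_le` with `B = G = |X|²`. -/
theorem sum_frob_comm_le [DecidableEq ι] (A : α → Matrix ι ι ℝ)
    (hA : ∀ a, (A a).transpose = A a) (v : α → ℝ) (hv : ∑ a, v a ^ 2 = 1)
    (hmax : ∀ w : α → ℝ, frob (∑ a, w a • A a) (∑ a, w a • A a) ≤
      frob (∑ a, v a • A a) (∑ a, v a • A a) * ∑ a, w a ^ 2) :
    ∑ a, frob (matComm (∑ b, v b • A b) (A a)) (matComm (∑ b, v b • A b) (A a)) ≤
      frob (∑ a, v a • A a) (∑ a, v a • A a) * ∑ a, frob (A a) (A a) := by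
  have hsX : (∑ a, v a • A a).transpose = ∑ a, v a • A a := by
    simp [Matrix.transpose_sum, Matrix.transpose_smul, hA]
  obtain ⟨U, η, hU, hD⟩ := exists_orthogonal_diagonalization _ hsX
  set B : α → Matrix ι ι ℝ := fun a => U.transpose * A a * U with hBdef
  have hBsymm : ∀ a i j, B a i j = B a j i := fun a i j => by
    have : (B a).transpose = B a := by
      simp only [hBdef, Matrix.transpose_mul, Matrix.transpose_transpose, hA, Matrix.mul_assoc]
    exact congrFun (congrFun this j) i
  have hlin : ∀ w : α → ℝ, U.transpose * (∑ a, w a • A a) * U = ∑ a, w a • B a := fun w => by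
    simp [hBdef, Matrix.mul_sum, Matrix.sum_mul]
  have hG : frob (∑ a, v a • A a) (∑ a, v a • A a) = ∑ i, η i ^ 2 := by
    rw [← frob_conj U _ _ hU, hD]
    simp [frob, Matrix.diagonal_apply, sq]
  have hmaxB : ∀ w : α → ℝ, frob (∑ a, w a • B a) (∑ a, w a • B a) ≤
      (∑ i, η i ^ 2) * ∑ a, w a ^ 2 := fun w => by
    rw [← hlin, frob_conj U _ _ hU, ← hG]; exact hmax w
  have hcomm : ∀ a, frob (matComm (∑ b, v b • A b) (A a)) (matComm (∑ b, v b • A b) (A a)) =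
      ∑ i, ∑ j, (η i - η j) ^ 2 * B a i j ^ 2 := fun a => by
    rw [← frob_conj U _ _ hU, ← matComm_conj U _ _ hU, hD]
    simp only [frob, matComm, Matrix.sub_apply, Matrix.diagonal_mul, Matrix.mul_diagonal]
    refine Finset.sum_congr rfl fun i _ => Finset.sum_congr rfl fun j _ => ?_
    simp only [hBdef]
    ring
  have hη : ∀ i, η i = ∑ a, v a * B a i i := fun i => by
    have := congrFun (congrFun (hD.symm.trans (hlin v)) i) i
    simpa [Matrix.sum_apply] using this
  set b : ι → ι → ℝ := fun i j => ∑ a, B a i j ^ 2 with hb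
  have hlhs : ∑ a, frob (matComm (∑ b, v b • A b) (A a)) (matComm (∑ b, v b • A b) (A a)) =
      ∑ i, ∑ j, (η i - η j) ^ 2 * b i j := by
    simp only [hcomm, hb, Finset.mul_sum]
    rw [Finset.sum_comm]
    exact Finset.sum_congr rfl fun i _ => Finset.sum_comm
  have hS : ∑ a, frob (A a) (A a) = ∑ i, ∑ j, b i j := by
    have : ∀ a, frob (A a) (A a) = ∑ i, ∑ j, B a i j ^ 2 := fun a => by
      rw [← frob_conj U _ _ hU]; simp only [frob, sq, hBdef]
    simp only [this, hb]
    rw [Finset.sum_comm]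
    exact Finset.sum_congr rfl fun i _ => Finset.sum_comm
  have hG0 : 0 ≤ ∑ i, η i ^ 2 := by positivity
  have hoff : ∀ i j, i ≠ j → 2 * b i j ≤ ∑ i, η i ^ 2 := fun i j hij => by
    -- Maximality is tested on the vector of `(i, j)` entries. The resulting `Y` has the value `b i
    -- j` at both `(i, j)` and `(j, i)`, so `2 (b i j)² ≤ |Y|² ≤ G b i j`.
    have h1 := hmaxB fun a => B a i j
    set Y := ∑ a, B a i j • B a with hY
    have hYij : Y i j = b i j := by simp [hY, hb, Matrix.sum_apply, sq]
    have hYji : Y j i = b i j := by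
      simp only [hY, hb, Matrix.sum_apply, Matrix.smul_apply, smul_eq_mul, sq]
      exact Finset.sum_congr rfl fun a _ => by rw [hBsymm a j i]
    have h2 : 2 * b i j ^ 2 ≤ frob Y Y := by
      have := Finset.sum_le_univ_sum_of_nonneg (s := {((i, j) : ι × ι), (j, i)})
        (fun p => mul_self_nonneg (Y p.1 p.2))
      rw [Finset.sum_pair (by simp [hij]), Fintype.sum_prod_type] at this
      simp only [hYij, hYji] at this
      rw [frob]; linarith
    have hb0 : 0 ≤ b i j := by simp only [hb]; positivity
    rcases hb0.eq_or_lt with h0 | h0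
    · rw [← h0]; simpa using hG0
    · have h3 : (2 * b i j) * b i j ≤ (∑ i, η i ^ 2) * b i j := by
        have : (∑ a, (fun a => B a i j) a ^ 2) = b i j := rfl
        rw [this] at h1
        linarith
      exact le_of_mul_le_mul_right h3 h0
  -- Cauchy–Schwarz for `η i = ∑ v a * B a i i` with `v` of norm one; this pays for the term `+ B`.
  have hdiag : ∑ i, η i ^ 2 ≤ ∑ i, b i i := by
    refine Finset.sum_le_sum fun i _ => ?_
    rw [hη i]
    have := Finset.sum_mul_sq_le_sq_mul_sq Finset.univ v fun a => B a i i
    rwa [hv, one_mul] at this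
  rw [hlhs, hG, hS]
  refine (sum_gap_sq_mul_le η b (fun i j => by simp only [hb]; positivity)
    (fun i j => by simp only [hb, hBsymm _ i j]) hG0 hoff).trans ?_
  exact mul_le_mul_of_nonneg_left (by linarith) hG0

end MatrixInequality

end SubmanifoldGeometry

namespace SubmanifoldGeometry

/-! ### The commutator inequality for a family of symmetric matrices. -/

section CommutatorInequality

variable {ι α : Type*} [Fintype ι] [Fintype α]

/-- The sum of the squared norms of the commutators of a family of matrices. -/
def commSq (A : α → Matrix ι ι ℝ) : ℝ := ∑ a, ∑ b, frob (matComm (A a) (A b)) (matComm (A a) (A b))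

/-- The sum of the squared norms of a family of matrices. -/
def normSq (A : α → Matrix ι ι ℝ) : ℝ := ∑ a, frob (A a) (A a)

theorem matComm_sum_left (A : α → Matrix ι ι ℝ) (B : Matrix ι ι ℝ) (v : α → ℝ) :
    matComm (∑ a, v a • A a) B = ∑ a, v a • matComm (A a) B := by
  simp [matComm, Matrix.sum_mul, Matrix.mul_sum, smul_sub]

theorem matComm_antisymm (A B : Matrix ι ι ℝ) : matComm A B = (-1 : ℝ) • matComm B A := by
  simp [matComm]

theorem matComm_smul (s t : ℝ) (A B : Matrix ι ι ℝ) :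
    matComm (s • A) (t • B) = (s * t) • matComm A B := by
  simp only [matComm, smul_sub, Matrix.smul_mul, Matrix.mul_smul, smul_smul, mul_comm t s]

theorem commSq_smul (s : ℝ) (A : α → Matrix ι ι ℝ) : commSq (fun a => s • A a) = s ^ 4 * commSq A := by
  simp only [commSq, matComm_smul, frob_smul_left, frob_smul_right, Finset.mul_sum]
  exact Finset.sum_congr rfl fun _ _ => Finset.sum_congr rfl fun _ _ => by ring

theorem normSq_smul (s : ℝ) (A : α → Matrix ι ι ℝ) : normSq (fun a => s • A a) = s ^ 2 * normSq A := by
  simp only [normSq, frob_smul_left, frob_smul_right, Finset.mul_sum]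
  exact Finset.sum_congr rfl fun _ _ => by ring

theorem normSq_nonneg (A : α → Matrix ι ι ℝ) : 0 ≤ normSq A :=
  Finset.sum_nonneg fun _ _ => frob_self_nonneg _

theorem eq_zero_of_frob_self_eq_zero {A : Matrix ι ι ℝ} (h : frob A A = 0) : A = 0 := by
  ext i j
  have h1 := (Finset.sum_eq_zero_iff_of_nonneg fun i _ =>
    Finset.sum_nonneg fun j _ => mul_self_nonneg (A i j)).1 h i (Finset.mem_univ i)
  have h2 := (Finset.sum_eq_zero_iff_of_nonneg fun j _ => mul_self_nonneg (A i j)).1 h1 j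
    (Finset.mem_univ j)
  exact mul_self_eq_zero.1 h2

theorem eq_zero_of_normSq_eq_zero {A : α → Matrix ι ι ℝ} (h : normSq A = 0) (a : α) : A a = 0 :=
  eq_zero_of_frob_self_eq_zero
    ((Finset.sum_eq_zero_iff_of_nonneg fun _ _ => frob_self_nonneg _).1 h a (Finset.mem_univ a))

theorem continuous_normSq : Continuous fun A : α → ι → ι → ℝ => normSq (A : α → Matrix ι ι ℝ) := by
  unfold normSq frob
  fun_prop

theorem continuous_commSq : Continuous fun A : α → ι → ι → ℝ => commSq (A : α → Matrix ι ι ℝ) := by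
  unfold commSq frob matComm
  simp only [Matrix.sub_apply]
  fun_prop

theorem isCompact_symm_normSq_eq_one :
    IsCompact {A : α → ι → ι → ℝ | (∀ a i j, A a i j = A a j i) ∧
      normSq (A : α → Matrix ι ι ℝ) = 1} := by
  refine Metric.isCompact_of_isClosed_isBounded ?_ ?_
  · have h1 : IsClosed {A : α → ι → ι → ℝ | ∀ a i j, A a i j = A a j i} := by
      simp only [Set.ofPred_forall]
      exact isClosed_iInter fun a => isClosed_iInter fun i => isClosed_iInter fun j =>
        isClosed_eq (by fun_prop) (by fun_prop)
    exact h1.inter (isClosed_eq continuous_normSq continuous_const)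
  · refine (Metric.isBounded_closedBall (x := (0 : α → ι → ι → ℝ)) (r := 1)).subset ?_
    rintro A ⟨-, hA⟩
    rw [mem_closedBall_zero_iff]
    refine (pi_norm_le_iff_of_nonneg zero_le_one).2 fun a =>
      (pi_norm_le_iff_of_nonneg zero_le_one).2 fun i =>
      (pi_norm_le_iff_of_nonneg zero_le_one).2 fun j => ?_
    have h1 : frob (A a : Matrix ι ι ℝ) (A a) ≤ normSq (A : α → Matrix ι ι ℝ) :=
      Finset.single_le_sum (f := fun a => frob (A a : Matrix ι ι ℝ) (A a))
        (fun a _ => frob_self_nonneg _) (Finset.mem_univ a)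
    have h2 : ∑ j, A a i j * A a i j ≤ frob (A a : Matrix ι ι ℝ) (A a) :=
      Finset.single_le_sum (f := fun i => ∑ j, A a i j * A a i j)
        (fun i _ => Finset.sum_nonneg fun j _ => mul_self_nonneg _) (Finset.mem_univ i)
    have h3 : A a i j * A a i j ≤ ∑ j, A a i j * A a i j :=
      Finset.single_le_sum (f := fun j => A a i j * A a i j)
        (fun j _ => mul_self_nonneg _) (Finset.mem_univ j)
    rw [Real.norm_eq_abs]
    refine abs_le_one_iff_mul_self_le_one.2 (by linarith)

theorem exists_max_direction [Nonempty α] (A : α → Matrix ι ι ℝ) :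
    ∃ v : α → ℝ, ∑ a, v a ^ 2 = 1 ∧ ∀ w : α → ℝ,
      frob (∑ a, w a • A a) (∑ a, w a • A a) ≤
        frob (∑ a, v a • A a) (∑ a, v a • A a) * ∑ a, w a ^ 2 := by
  classical
  have hcomp : IsCompact {v : α → ℝ | ∑ a, v a ^ 2 = 1} := by
    refine Metric.isCompact_of_isClosed_isBounded
      (isClosed_eq (by fun_prop) continuous_const) ?_
    refine (Metric.isBounded_closedBall (x := (0 : α → ℝ)) (r := 1)).subset fun v hv => ?_
    rw [mem_closedBall_zero_iff]
    refine (pi_norm_le_iff_of_nonneg zero_le_one).2 fun a => ?_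
    have h3 : v a ^ 2 ≤ ∑ a, v a ^ 2 :=
      Finset.single_le_sum (f := fun a => v a ^ 2) (fun _ _ => sq_nonneg _) (Finset.mem_univ a)
    rw [Set.mem_ofPred_eq] at hv
    rw [Real.norm_eq_abs]
    exact abs_le_one_iff_mul_self_le_one.2 (by nlinarith)
  have hne : {v : α → ℝ | ∑ a, v a ^ 2 = 1}.Nonempty := by
    obtain ⟨a⟩ := ‹Nonempty α›
    refine ⟨Pi.single a 1, ?_⟩
    simp [Pi.single_apply]
  have hcont : Continuous fun v : α → ℝ => frob (∑ a, v a • A a) (∑ a, v a • A a) := by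
    unfold frob
    simp only [Matrix.sum_apply, Matrix.smul_apply]
    fun_prop
  obtain ⟨v, hv, hmax⟩ := hcomp.exists_isMaxOn hne hcont.continuousOn
  refine ⟨v, hv, fun w => ?_⟩
  set t := ∑ a, w a ^ 2 with ht
  have ht0 : 0 ≤ t := by positivity
  rcases ht0.eq_or_lt with h0 | h0
  · have hw : ∀ a, w a = 0 := fun a => by
      have := (Finset.sum_eq_zero_iff_of_nonneg fun a _ => sq_nonneg (w a)).1
        (ht.symm.trans h0.symm) a (Finset.mem_univ a)
      simpa using this
    simp [hw, frob, ← h0]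
  · set u : α → ℝ := fun a => (Real.sqrt t)⁻¹ * w a with hu
    have hs : (Real.sqrt t)⁻¹ ^ 2 = t⁻¹ := by rw [inv_pow, Real.sq_sqrt ht0]
    have hu1 : ∑ a, u a ^ 2 = 1 := by
      simp only [hu, mul_pow, ← Finset.mul_sum, hs]
      exact inv_mul_cancel₀ h0.ne'
    have h1 : frob (∑ a, u a • A a) (∑ a, u a • A a) ≤ _ := hmax hu1
    have h2 : ∑ a, u a • A a = (Real.sqrt t)⁻¹ • ∑ a, w a • A a := by
      simp [hu, Finset.smul_sum, smul_smul]
    rw [h2, frob_smul_left, frob_smul_right, ← mul_assoc, ← sq, hs] at h1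
    rwa [inv_mul_le_iff₀ h0, mul_comm] at h1

/-- Since `[X, X] = 0`, each commutator is affine in `s`, of the form `C + s Z`, and `|C + s Z|² ≥
|C|² + 2 s ⟨C, Z⟩`. Summed against `v`, each of the two parts of `Z` contributes `∑ |[X, A b]|²`,
hence the factor `4`. -/
theorem commSq_variation (A : α → Matrix ι ι ℝ) (v : α → ℝ) (s : ℝ) :
    commSq A + 4 * s * ∑ b, frob (matComm (∑ a, v a • A a) (A b)) (matComm (∑ a, v a • A a) (A b)) ≤
      commSq (fun a => A a + (s * v a) • ∑ c, v c • A c) := by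
  set X := ∑ a, v a • A a with hX
  have h1 : ∀ a b, matComm (A a + (s * v a) • X) (A b + (s * v b) • X) =
      matComm (A a) (A b) + s • (v a • matComm X (A b) + v b • matComm (A a) X) := fun a b => by
    simp only [matComm, Matrix.add_mul, Matrix.mul_add, Matrix.smul_mul, Matrix.mul_smul, smul_sub,
      smul_add, smul_smul]
    rw [mul_comm (s * v a) (s * v b)]
    abel
  have h2 : ∀ a b, frob (matComm (A a) (A b)) (matComm (A a) (A b)) +
      2 * s * (v a * frob (matComm (A a) (A b)) (matComm X (A b)) +
        v b * frob (matComm (A a) (A b)) (matComm (A a) X)) ≤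
      frob (matComm (A a + (s * v a) • X) (A b + (s * v b) • X))
        (matComm (A a + (s * v a) • X) (A b + (s * v b) • X)) := fun a b => by
    rw [h1]
    set Z := v a • matComm X (A b) + v b • matComm (A a) X with hZ
    have h3 : frob (matComm (A a) (A b)) Z = v a * frob (matComm (A a) (A b)) (matComm X (A b)) +
        v b * frob (matComm (A a) (A b)) (matComm (A a) X) := by
      rw [hZ, frob_add_right, frob_smul_right, frob_smul_right]
    rw [← h3]
    clear_value Z
    generalize matComm (A a) (A b) = C
    rw [frob_add_left, frob_add_right, frob_add_right, frob_smul_left, frob_smul_left,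
      frob_smul_right, frob_smul_right, frob_comm Z]
    nlinarith [mul_nonneg (sq_nonneg s) (frob_self_nonneg Z)]
  have h4 : ∀ b, ∑ a, v a * frob (matComm (A a) (A b)) (matComm X (A b)) =
      frob (matComm X (A b)) (matComm X (A b)) := fun b => by
    have h5 : matComm X (A b) = ∑ a, v a • matComm (A a) (A b) := by rw [hX, matComm_sum_left]
    nth_rewrite 2 [h5]
    simp only [frob_sum_left, frob_smul_left]
  have h5 : ∀ a, ∑ b, v b * frob (matComm (A a) (A b)) (matComm (A a) X) =
      frob (matComm X (A a)) (matComm X (A a)) := fun a => by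
    rw [← h4 a]
    refine Finset.sum_congr rfl fun b _ => ?_
    rw [matComm_antisymm (A a) (A b), matComm_antisymm (A a) X, frob_smul_left, frob_smul_right]
    ring
  have h6 := Finset.sum_le_sum fun a (_ : a ∈ Finset.univ) =>
    Finset.sum_le_sum fun b (_ : b ∈ Finset.univ) => h2 a b
  refine le_trans (le_of_eq ?_) h6
  simp only [Finset.sum_add_distrib, ← Finset.mul_sum]
  have h7 : ∑ a, ∑ b, v a * frob (matComm (A a) (A b)) (matComm X (A b)) =
      ∑ b, frob (matComm X (A b)) (matComm X (A b)) := by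
    rw [Finset.sum_comm]; exact Finset.sum_congr rfl fun b _ => h4 b
  have h8 : ∑ a, ∑ b, v b * frob (matComm (A a) (A b)) (matComm (A a) X) =
      ∑ b, frob (matComm X (A b)) (matComm X (A b)) := Finset.sum_congr rfl fun a _ => h5 a
  rw [show ∑ a, v a * ∑ b, frob (matComm (A a) (A b)) (matComm X (A b)) =
    ∑ a, ∑ b, v a * frob (matComm (A a) (A b)) (matComm X (A b)) by simp only [Finset.mul_sum],
    h7, h8, commSq]
  ring

theorem normSq_variation (A : α → Matrix ι ι ℝ) (v : α → ℝ) (hv : ∑ a, v a ^ 2 = 1) (s : ℝ) :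
    normSq (fun a => A a + (s * v a) • ∑ c, v c • A c) =
      normSq A + (2 * s + s ^ 2) * frob (∑ c, v c • A c) (∑ c, v c • A c) := by
  set X := ∑ a, v a • A a with hX
  have h1 : ∑ a, v a * frob (A a) X = frob X X := by
    nth_rewrite 2 [hX]
    simp only [frob_sum_left, frob_smul_left]
  have h2 : ∀ a, frob (A a + (s * v a) • X) (A a + (s * v a) • X) =
      frob (A a) (A a) + 2 * s * (v a * frob (A a) X) + s ^ 2 * frob X X * v a ^ 2 := fun a => by
    rw [frob_add_left, frob_add_right, frob_add_right, frob_smul_left, frob_smul_left,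
      frob_smul_right, frob_smul_right, frob_comm X (A a)]
    ring
  simp only [normSq, h2, Finset.sum_add_distrib, ← Finset.mul_sum, h1, hv]
  ring

/-- Equality holds at `s = 0`, so the difference of the two sides has a minimum there and its
derivative `4 q g - 4 T` vanishes. -/
theorem eq_of_forall_quartic_le {q g T : ℝ}
    (h : ∀ s : ℝ, q + 4 * s * T ≤ q * (1 + (2 * s + s ^ 2) * g) ^ 2) : q * g = T := by
  have hd : HasDerivAt (fun s : ℝ => q * (1 + (2 * s + s ^ 2) * g) ^ 2 - (q + 4 * s * T))
      (4 * (q * g) - 4 * T) 0 := by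
    have h1 : HasDerivAt (fun s : ℝ => 1 + (2 * s + s ^ 2) * g) (2 * g) 0 := by
      have := ((((hasDerivAt_id (0 : ℝ)).const_mul 2).add (hasDerivAt_pow 2 (0 : ℝ))).mul_const
        g).const_add 1
      exact this.congr_deriv (by simp)
    have h2 := (h1.pow 2).const_mul q
    have h3 : HasDerivAt (fun s : ℝ => q + 4 * s * T) (4 * T) 0 := by
      have := (((hasDerivAt_id (0 : ℝ)).const_mul 4).mul_const T).const_add q
      exact this.congr_deriv (by simp)
    exact (h2.sub h3).congr_deriv (by simp; ring)
  have hmin : IsLocalMin (fun s : ℝ => q * (1 + (2 * s + s ^ 2) * g) ^ 2 - (q + 4 * s * T)) 0 :=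
    Filter.Eventually.of_forall fun s => by
      have := h s
      simp only
      linarith
  linarith [hmin.hasDerivAt_eq_zero hd]

/-- The Böttcher–Wenzel type inequality for several symmetric matrices (the algebraic form of the
normal scalar curvature inequality). -/
theorem commSq_le_normSq_sq (A : α → Matrix ι ι ℝ) (hA : ∀ a, (A a).transpose = A a) :
    commSq A ≤ normSq A ^ 2 := by
  classical
  have hzero : ∀ A : α → Matrix ι ι ℝ, normSq A = 0 → commSq A = 0 := fun A h => by
    simp [commSq, eq_zero_of_normSq_eq_zero h, matComm, frob]
  have hsymm : ∀ {B : α → Matrix ι ι ℝ}, (∀ a, (B a).transpose = B a) →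
      ∀ a i j, B a i j = B a j i := fun {B} h a i j => congrFun (congrFun (h a) j) i
  have hscale : ∀ B : α → Matrix ι ι ℝ, normSq B ≠ 0 →
      normSq (fun a => (Real.sqrt (normSq B))⁻¹ • B a) = 1 ∧
        commSq B = normSq B ^ 2 * commSq (fun a => (Real.sqrt (normSq B))⁻¹ • B a) := fun B hB => by
    have h1 : (Real.sqrt (normSq B))⁻¹ ^ 2 = (normSq B)⁻¹ := by
      rw [inv_pow, Real.sq_sqrt (normSq_nonneg B)]
    refine ⟨by rw [normSq_smul, h1, inv_mul_cancel₀ hB], ?_⟩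
    rw [commSq_smul, show (Real.sqrt (normSq B))⁻¹ ^ 4 = ((Real.sqrt (normSq B))⁻¹ ^ 2) ^ 2 by ring,
      h1]
    field_simp
  by_cases hA0 : normSq A = 0
  · rw [hzero A hA0]; positivity
  have hsmul : ∀ (s : ℝ) (B : α → Matrix ι ι ℝ), (∀ a, (B a).transpose = B a) →
      ∀ a, (s • B a).transpose = s • B a := fun s B hB a => by rw [Matrix.transpose_smul, hB]
  obtain ⟨A₀, ⟨hA₀s, hA₀n⟩, hmax⟩ :=
    (isCompact_symm_normSq_eq_one (α := α) (ι := ι)).exists_isMaxOn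
      ⟨fun a => (Real.sqrt (normSq A))⁻¹ • A a, hsymm (hsmul _ _ hA), (hscale A hA0).1⟩
      continuous_commSq.continuousOn
  set B : α → Matrix ι ι ℝ := A₀ with hB
  have hBs : ∀ a, (B a).transpose = B a := fun a => by
    ext i j; exact hA₀s a j i
  have hle : ∀ C : α → Matrix ι ι ℝ, (∀ a, (C a).transpose = C a) →
      commSq C ≤ commSq B * normSq C ^ 2 := fun C hC => by
    by_cases hC0 : normSq C = 0
    · rw [hzero C hC0, hC0]; simp
    · rw [(hscale C hC0).2, mul_comm]
      exact mul_le_mul_of_nonneg_right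
        (hmax ⟨hsymm (hsmul _ _ hC), (hscale C hC0).1⟩) (sq_nonneg _)
  have hBn : normSq B = 1 := hA₀n
  -- An empty index type, as in codimension zero, is excluded because `normSq B = 1`.
  have hne : Nonempty α := by
    by_contra hcon
    rw [not_nonempty_iff] at hcon
    simp [normSq] at hBn
  obtain ⟨v, hv, hvmax⟩ := exists_max_direction B
  have hkey := sum_frob_comm_le B hBs v hv hvmax
  set X := ∑ a, v a • B a with hX
  have hXs : X.transpose = X := by
    simp [hX, Matrix.transpose_sum, Matrix.transpose_smul, hBs]
  -- The Euler–Lagrange equation of the maximizer in the direction `a ↦ v a • X`.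
  have hEL : commSq B * frob X X = ∑ b, frob (matComm X (B b)) (matComm X (B b)) := by
    refine eq_of_forall_quartic_le fun s => ?_
    have h1 := hle (fun a => B a + (s * v a) • X) fun a => by
      rw [Matrix.transpose_add, Matrix.transpose_smul, hBs, hXs]
    rw [hX, normSq_variation B v hv s, hBn] at h1
    exact (commSq_variation B v s).trans h1
  -- If the largest combination were zero, then testing on coordinate vectors would make every `B a`
  -- zero.
  have hXpos : 0 < frob X X := by
    refine (frob_self_nonneg X).lt_of_ne' fun h0 => ?_
    have : normSq B = 0 := Finset.sum_eq_zero fun a _ => by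
      have h1 := hvmax (Pi.single a 1)
      rw [h0, zero_mul] at h1
      have h2 : ∑ b, (Pi.single a 1 : α → ℝ) b • B b = B a := by
        simp [Pi.single_apply, ite_smul]
      rw [h2] at h1
      exact le_antisymm h1 (frob_self_nonneg _)
    rw [hBn] at this
    exact one_ne_zero this
  have hq : commSq B ≤ 1 := by
    have : commSq B * frob X X ≤ 1 * frob X X := by
      rw [hEL, one_mul]
      refine hkey.trans (le_of_eq ?_)
      rw [show ∑ a, frob (B a) (B a) = 1 from hBn, mul_one]
    exact le_of_mul_le_mul_right this hXpos
  exact (hle A hA).trans (mul_le_of_le_one_left (sq_nonneg _) hq)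

end CommutatorInequality

end SubmanifoldGeometry

namespace SubmanifoldGeometry

set_option maxSynthPendingDepth 3

open Filter Topology

/-! ### Inner products on a finite-dimensional space. -/

section BilinearForms

variable {E : Type*} [NormedAddCommGroup E] [NormedSpace ℝ E]

/-- `B` is a Euclidean inner product. -/
structure IsInnerProduct (B : E →L[ℝ] E →L[ℝ] ℝ) : Prop where
  symm : ∀ u v, B u v = B v u
  pos : ∀ u, u ≠ 0 → 0 < B u u

theorem IsInnerProduct.ext {B : E →L[ℝ] E →L[ℝ] ℝ} (hB : IsInnerProduct B) {u v : E}
    (h : ∀ w, B u w = B v w) : u = v := by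
  by_contra hne
  have := hB.pos (u - v) (sub_ne_zero.2 hne)
  simp [h] at this

theorem IsInnerProduct.isInvertible [FiniteDimensional ℝ E] {B : E →L[ℝ] E →L[ℝ] ℝ}
    (hB : IsInnerProduct B) : B.IsInvertible := by
  have hinj : Function.Injective (B : E →ₗ[ℝ] E →L[ℝ] ℝ) := fun u v h =>
    hB.ext fun w => by simpa using congrArg (fun L : E →L[ℝ] ℝ => L w) h
  have hdim : Module.finrank ℝ E = Module.finrank ℝ (E →L[ℝ] ℝ) := by
    rw [← Subspace.dual_finrank_eq (K := ℝ) (V := E)]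
    exact (LinearMap.toContinuousLinearMap (𝕜 := ℝ) (E := E) (F' := ℝ)).finrank_eq
  refine ⟨(LinearEquiv.ofInjectiveOfFinrankEq (B : E →ₗ[ℝ] E →L[ℝ] ℝ) hinj
    hdim).toContinuousLinearEquiv, ?_⟩
  ext u v
  rfl

theorem IsInnerProduct.apply_inverse [FiniteDimensional ℝ E] {B : E →L[ℝ] E →L[ℝ] ℝ}
    (hB : IsInnerProduct B) (L : E →L[ℝ] ℝ) : B (B.inverse L) = L :=
  hB.isInvertible.self_apply_inverse L

/-- An orthonormal family is independent, and the cardinality hypothesis makes it a basis; no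
spanning assumption is needed. -/
theorem sum_apply_smul_of_orthonormal [FiniteDimensional ℝ E] {B : E →L[ℝ] E →L[ℝ] ℝ}
    {ι : Type*} [Fintype ι] [DecidableEq ι] {b : ι → E}
    (hb : ∀ i j, B (b i) (b j) = if i = j then 1 else 0)
    (hcard : Fintype.card ι = Module.finrank ℝ E) (v : E) : ∑ i, B v (b i) • b i = v := by
  have hlin : LinearIndependent ℝ b := by
    rw [Fintype.linearIndependent_iff]
    intro g hg i
    have := congrArg (fun w => B w (b i)) hg
    simpa [hb] using this
  have hspan : Submodule.span ℝ (Set.range b) = ⊤ := hlin.span_eq_top_of_card_eq_finrank' hcard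
  obtain ⟨g, hg⟩ := (Submodule.mem_span_range_iff_exists_fun ℝ).1
    (hspan ▸ Submodule.mem_top : v ∈ Submodule.span ℝ (Set.range b))
  rw [← hg]
  refine Finset.sum_congr rfl fun i _ => ?_
  congr 1
  simp [hb]

end BilinearForms

/-! ### Christoffel symbols: regularity, symmetry and metric compatibility. -/

section Metrics

variable {E : Type*} [NormedAddCommGroup E] [NormedSpace ℝ E]

/-- `G` is a twice continuously differentiable Riemannian metric near `p`. -/
structure IsMetricAt (G : E → E →L[ℝ] E →L[ℝ] ℝ) (p : E) : Prop where
  contDiffAt : ContDiffAt ℝ 2 G p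
  inner : ∀ᶠ q in 𝓝 p, IsInnerProduct (G q)

variable {G : E → E →L[ℝ] E →L[ℝ] ℝ} {p : E}

theorem IsMetricAt.self (h : IsMetricAt G p) : IsInnerProduct (G p) := h.inner.self_of_nhds

theorem IsMetricAt.eventually (h : IsMetricAt G p) : ∀ᶠ q in 𝓝 p, IsMetricAt G q := by
  filter_upwards [h.contDiffAt.eventually (by simp), h.inner.eventually_nhds] with q h1 h2
  exact ⟨h1, h2⟩

theorem IsMetricAt.differentiableAt (h : IsMetricAt G p) : DifferentiableAt ℝ G p :=
  h.contDiffAt.differentiableAt (by simp)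

theorem fderiv_apply_apply {G : E → E →L[ℝ] E →L[ℝ] ℝ} (h : DifferentiableAt ℝ G p) (u v w : E) :
    fderiv ℝ (fun q => G q v w) p u = fderiv ℝ G p u v w := by
  have := ((h.hasFDerivAt.clm_apply (hasFDerivAt_const v p)).clm_apply (hasFDerivAt_const w p))
  rw [this.fderiv]
  simp

theorem IsMetricAt.fderiv_symm (h : IsMetricAt G p) (u v w : E) :
    fderiv ℝ G p u v w = fderiv ℝ G p u w v := by
  rw [← fderiv_apply_apply h.differentiableAt, ← fderiv_apply_apply h.differentiableAt]
  have : (fun q => G q v w) =ᶠ[𝓝 p] fun q => G q w v := by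
    filter_upwards [h.inner] with q hq using hq.symm v w
  rw [this.fderiv_eq]

/-- The Christoffel symbols as a bilinear map. -/
noncomputable def christoffelMap (G : E → E →L[ℝ] E →L[ℝ] ℝ) (p : E) : E →L[ℝ] E →L[ℝ] E :=
  (ContinuousLinearMap.compL ℝ E (E →L[ℝ] ℝ) E (G p).inverse).comp
    ((1 / 2 : ℝ) • (fderiv ℝ G p + (fderiv ℝ G p).flip
      - ((ContinuousLinearMap.flipₗᵢ ℝ E E ℝ).toContinuousLinearEquiv :
        (E →L[ℝ] E →L[ℝ] ℝ) →L[ℝ] (E →L[ℝ] E →L[ℝ] ℝ)).comp (fderiv ℝ G p).flip))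

theorem christoffelMap_apply (u v : E) : christoffelMap G p u v = christoffel G p u v := rfl

variable [FiniteDimensional ℝ E]

theorem IsMetricAt.apply_christoffelMap (h : IsMetricAt G p) (u v w : E) :
    G p (christoffelMap G p u v) w =
      (fderiv ℝ G p u v w + fderiv ℝ G p v u w - fderiv ℝ G p w u v) / 2 := by
  rw [christoffelMap_apply, christoffel, h.self.apply_inverse]
  simp
  ring

theorem IsMetricAt.christoffelMap_symm (h : IsMetricAt G p) (u v : E) :
    christoffelMap G p u v = christoffelMap G p v u :=
  h.self.ext fun w => by
    rw [h.apply_christoffelMap, h.apply_christoffelMap, h.fderiv_symm w u v]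
    ring

/-- Metric compatibility of the Levi-Civita connection: in the sum of two Koszul formulas all but
one derivative of `G` cancel. -/
theorem IsMetricAt.fderiv_eq (h : IsMetricAt G p) (u v w : E) :
    fderiv ℝ G p u v w = G p (christoffelMap G p u v) w + G p v (christoffelMap G p u w) := by
  rw [h.self.symm v, h.apply_christoffelMap, h.apply_christoffelMap, h.fderiv_symm u w v,
    h.fderiv_symm v u w, h.fderiv_symm w u v]
  ring

theorem IsMetricAt.contDiffAt_inverse (h : IsMetricAt G p) :
    ContDiffAt ℝ 2 (fun q => (G q).inverse) p := by
  have : CompleteSpace E := FiniteDimensional.complete ℝ E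
  exact h.self.isInvertible.contDiffAt_map_inverse.comp p h.contDiffAt

theorem IsMetricAt.contDiffAt_christoffelMap (h : IsMetricAt G p) :
    ContDiffAt ℝ 1 (christoffelMap G) p := by
  have h1 : ContDiffAt ℝ 1 (fderiv ℝ G) p := h.contDiffAt.fderiv_right (by norm_num)
  have h2 : ContDiffAt ℝ 1 (fun q => (fderiv ℝ G q).flip) p :=
    (ContinuousLinearMap.flipₗᵢ ℝ E E (E →L[ℝ] ℝ)).contDiff.contDiffAt.comp p h1
  have h3 := (h.contDiffAt_inverse).of_le (m := 1) (by norm_num)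
  unfold christoffelMap
  exact ((ContinuousLinearMap.compL ℝ E (E →L[ℝ] ℝ) E).contDiff.contDiffAt.comp p h3).clm_comp
    (((h1.add h2).sub (contDiffAt_const.clm_comp h2)).const_smul (1 / 2 : ℝ))

end Metrics

end SubmanifoldGeometry

namespace SubmanifoldGeometry

set_option maxSynthPendingDepth 3

open Filter Topology

/-! ### Covariant derivatives along a map and their curvature. -/

section Along

variable {E E' : Type*} [NormedAddCommGroup E] [NormedSpace ℝ E]
  [NormedAddCommGroup E'] [NormedSpace ℝ E']
  {G : E' → E' →L[ℝ] E' →L[ℝ] ℝ} {F : E → E'} {y : E}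

theorem covDerivAlong_const (u : E) (V : E → E') (y : E) :
    covDerivAlong G F (fun _ => u) V y =
      fderiv ℝ V y u + christoffelMap G (F y) (fderiv ℝ F y u) (V y) := rfl

theorem covDeriv_const (u : E') (V : E' → E') (p : E') :
    covDeriv G (fun _ => u) V p = fderiv ℝ V p u + christoffelMap G p u (V p) := rfl

theorem covDerivAlong_congr {X : E → E} {V W : E → E'} (h : V =ᶠ[𝓝 y] W) :
    covDerivAlong G F X V y = covDerivAlong G F X W y := by
  simp only [covDerivAlong, h.fderiv_eq, h.eq_of_nhds]

theorem covDerivAlong_add {X : E → E} {V W : E → E'} (hV : DifferentiableAt ℝ V y)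
    (hW : DifferentiableAt ℝ W y) :
    covDerivAlong G F X (fun z => V z + W z) y =
      covDerivAlong G F X V y + covDerivAlong G F X W y := by
  simp only [covDerivAlong, fderiv_fun_add hV hW, ← christoffelMap_apply, map_add,
    add_apply]
  abel

theorem covDerivAlong_sub {X : E → E} {V W : E → E'} (hV : DifferentiableAt ℝ V y)
    (hW : DifferentiableAt ℝ W y) :
    covDerivAlong G F X (fun z => V z - W z) y =
      covDerivAlong G F X V y - covDerivAlong G F X W y := by
  simp only [covDerivAlong, fderiv_fun_sub hV hW, ← christoffelMap_apply, map_sub,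
    sub_apply]
  abel

/-- The curvature tensor in coordinates, as a function of vectors. -/
noncomputable def curvatureAt (G : E' → E' →L[ℝ] E' →L[ℝ] ℝ) (p a b c : E') : E' :=
  fderiv ℝ (christoffelMap G) p a b c - fderiv ℝ (christoffelMap G) p b a c
    + christoffelMap G p a (christoffelMap G p b c) - christoffelMap G p b (christoffelMap G p a c)

theorem fderiv_fderiv_symm (hF : ContDiffAt ℝ 2 F y) (u v : E) :
    fderiv ℝ (fderiv ℝ F) y u v = fderiv ℝ (fderiv ℝ F) y v u :=
  hF.isSymmSndFDerivAt (by simp) u v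

theorem fderiv_fderiv_apply (hF : ContDiffAt ℝ 2 F y) (u v : E) :
    fderiv ℝ (fun z => fderiv ℝ F z v) y u = fderiv ℝ (fderiv ℝ F) y u v := by
  have h : DifferentiableAt ℝ (fderiv ℝ F) y :=
    (hF.fderiv_right (m := 1) (by norm_num)).differentiableAt (by simp)
  rw [(h.hasFDerivAt.clm_apply (hasFDerivAt_const v y)).fderiv]
  simp

theorem contDiffAt_fderiv_apply_const {V : E → E'} {n k : ℕ∞ω} (hV : ContDiffAt ℝ n V y)
    (hk : k + 1 ≤ n) (u : E) : ContDiffAt ℝ k (fun z => fderiv ℝ V z u) y :=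
  (hV.fderiv_right hk).clm_apply contDiffAt_const

variable [FiniteDimensional ℝ E']

theorem fderiv_inner_along (hG : IsMetricAt G (F y)) (hF : DifferentiableAt ℝ F y)
    {V W : E → E'} (hV : DifferentiableAt ℝ V y) (hW : DifferentiableAt ℝ W y) (u : E) :
    fderiv ℝ (fun z => G (F z) (V z) (W z)) y u =
      G (F y) (covDerivAlong G F (fun _ => u) V y) (W y)
        + G (F y) (V y) (covDerivAlong G F (fun _ => u) W y) := by
  have h1 : HasFDerivAt (fun z => G (F z)) ((fderiv ℝ G (F y)).comp (fderiv ℝ F y)) y :=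
    hG.differentiableAt.hasFDerivAt.comp y hF.hasFDerivAt
  have h2 := (h1.clm_apply hV.hasFDerivAt).clm_apply hW.hasFDerivAt
  rw [h2.fderiv, covDerivAlong_const, covDerivAlong_const]
  simp [hG.fderiv_eq]
  ring

theorem covDerivAlong_fderiv_symm (hG : IsMetricAt G (F y)) (hF : ContDiffAt ℝ 2 F y) (u v : E) :
    covDerivAlong G F (fun _ => u) (fun z => fderiv ℝ F z v) y =
      covDerivAlong G F (fun _ => v) (fun z => fderiv ℝ F z u) y := by
  rw [covDerivAlong_const, covDerivAlong_const, fderiv_fderiv_apply hF, fderiv_fderiv_apply hF,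
    fderiv_fderiv_symm hF, hG.christoffelMap_symm]

theorem IsMetricAt.fderiv_christoffel_along (hG : IsMetricAt G (F y))
    (hF : DifferentiableAt ℝ F y) {V W : E → E'}
    (hV : DifferentiableAt ℝ V y) (hW : DifferentiableAt ℝ W y) (u : E) :
    fderiv ℝ (fun z => christoffelMap G (F z) (V z) (W z)) y u =
      fderiv ℝ (christoffelMap G) (F y) (fderiv ℝ F y u) (V y) (W y)
        + christoffelMap G (F y) (fderiv ℝ V y u) (W y)
        + christoffelMap G (F y) (V y) (fderiv ℝ W y u) := by
  have h0 : DifferentiableAt ℝ (christoffelMap G) (F y) :=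
    hG.contDiffAt_christoffelMap.differentiableAt (by simp)
  have h1 : HasFDerivAt (fun z => christoffelMap G (F z))
      ((fderiv ℝ (christoffelMap G) (F y)).comp (fderiv ℝ F y)) y :=
    h0.hasFDerivAt.comp y hF.hasFDerivAt
  rw [((h1.clm_apply hV.hasFDerivAt).clm_apply hW.hasFDerivAt).fderiv]
  simp
  abel

theorem IsMetricAt.contDiffAt_christoffel_along (hG : IsMetricAt G (F y))
    (hF : ContDiffAt ℝ 1 F y) {V W : E → E'}
    (hV : ContDiffAt ℝ 1 V y) (hW : ContDiffAt ℝ 1 W y) :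
    ContDiffAt ℝ 1 (fun z => christoffelMap G (F z) (V z) (W z)) y :=
  ((hG.contDiffAt_christoffelMap.comp y hF).clm_apply hV).clm_apply hW

theorem contDiffAt_covDerivAlong (hG : IsMetricAt G (F y)) (hF : ContDiffAt ℝ 2 F y)
    {V : E → E'} (hV : ContDiffAt ℝ 2 V y) (u : E) :
    ContDiffAt ℝ 1 (covDerivAlong G F (fun _ => u) V) y :=
  (contDiffAt_fderiv_apply_const hV (by norm_num) u).add
    (hG.contDiffAt_christoffel_along (hF.of_le (by norm_num))
      (contDiffAt_fderiv_apply_const hF (by norm_num) u) (hV.of_le (by norm_num)))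

/-- The curvature of the pull-back connection is the pull-back of the curvature. -/
theorem covDerivAlong_commutator (hG : IsMetricAt G (F y)) (hF : ContDiffAt ℝ 2 F y)
    {V : E → E'} (hV : ContDiffAt ℝ 2 V y) (u v : E) :
    covDerivAlong G F (fun _ => u) (covDerivAlong G F (fun _ => v) V) y
        - covDerivAlong G F (fun _ => v) (covDerivAlong G F (fun _ => u) V) y =
      curvatureAt G (F y) (fderiv ℝ F y u) (fderiv ℝ F y v) (V y) := by
  have hF1 : DifferentiableAt ℝ F y := hF.differentiableAt (by simp)
  have hV1 : DifferentiableAt ℝ V y := hV.differentiableAt (by simp)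
  have key : ∀ u v : E, covDerivAlong G F (fun _ => u) (covDerivAlong G F (fun _ => v) V) y =
      fderiv ℝ (fderiv ℝ V) y u v +
      (fderiv ℝ (christoffelMap G) (F y) (fderiv ℝ F y u) (fderiv ℝ F y v) (V y)
        + christoffelMap G (F y) (fderiv ℝ (fderiv ℝ F) y u v) (V y)
        + christoffelMap G (F y) (fderiv ℝ F y v) (fderiv ℝ V y u)) +
      (christoffelMap G (F y) (fderiv ℝ F y u) (fderiv ℝ V y v) +
        christoffelMap G (F y) (fderiv ℝ F y u)
          (christoffelMap G (F y) (fderiv ℝ F y v) (V y))) := fun u v => by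
    have hd1 : DifferentiableAt ℝ (fun z => fderiv ℝ V z v) y :=
      (contDiffAt_fderiv_apply_const hV (k := 1) (by norm_num) v).differentiableAt (by simp)
    have hd2 : DifferentiableAt ℝ (fun z => fderiv ℝ F z v) y :=
      (contDiffAt_fderiv_apply_const hF (k := 1) (by norm_num) v).differentiableAt (by simp)
    have hd3 : DifferentiableAt ℝ
        (fun z => christoffelMap G (F z) (fderiv ℝ F z v) (V z)) y :=
      (hG.contDiffAt_christoffel_along (hF.of_le (by norm_num))
        (contDiffAt_fderiv_apply_const hF (by norm_num) v)
        (hV.of_le (by norm_num))).differentiableAt (by simp)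
    rw [covDerivAlong_const]
    have h1 : fderiv ℝ (covDerivAlong G F (fun _ => v) V) y u =
        fderiv ℝ (fun z => fderiv ℝ V z v) y u +
          fderiv ℝ (fun z => christoffelMap G (F z) (fderiv ℝ F z v) (V z)) y u := by
      rw [show covDerivAlong G F (fun _ => v) V = fun z => fderiv ℝ V z v +
        christoffelMap G (F z) (fderiv ℝ F z v) (V z) from rfl, fderiv_fun_add hd1 hd3]
      rfl
    rw [h1, fderiv_fderiv_apply hV, hG.fderiv_christoffel_along hF1 hd2 hV1,
      fderiv_fderiv_apply hF, covDerivAlong_const, map_add]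
  -- Second derivatives of `F` and `V` cancel by symmetry. The terms with one derivative of `V`
  -- occur in both orders and cancel too, leaving a tensor.
  rw [key u v, key v u, curvatureAt, fderiv_fderiv_symm hF v u, fderiv_fderiv_symm hV v u]
  abel

/-- The case of the identity map in `covDerivAlong_commutator`; constant fields have zero bracket.
-/
theorem curvature_const (hG : IsMetricAt G p) (a b c : E') :
    curvature G (fun _ => a) (fun _ => b) (fun _ => c) p = curvatureAt G p a b c := by
  have hid : ∀ (u : E') (V : E' → E'),
      covDeriv G (fun _ => u) V = covDerivAlong G (fun z => z) (fun _ => u) V := fun u V => by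
    ext q
    rw [covDeriv_const, covDerivAlong_const]
    simp
  have hlie : VectorField.lieBracket ℝ (fun _ : E' => a) (fun _ : E' => b) = fun _ => 0 := by
    ext q
    simp [VectorField.lieBracket]
  have h0 : covDeriv G (fun _ => 0) (fun _ => c) p = 0 := by
    rw [covDeriv_const]; simp
  have h1 := covDerivAlong_commutator (F := fun z : E' => z) (V := fun _ => c) (y := p) hG
    contDiffAt_id contDiffAt_const a b
  rw [curvature, hlie, h0, sub_zero, hid, hid, hid, hid, h1]
  simp

end Along

end SubmanifoldGeometry

namespace SubmanifoldGeometry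

set_option maxSynthPendingDepth 3
set_option linter.unusedSectionVars false

open Filter Topology

/-! ### Gauss formula, Weingarten formula, Gauss and Ricci equations. -/

section Immersions

variable {E E' : Type*} [NormedAddCommGroup E] [NormedSpace ℝ E]
  [NormedAddCommGroup E'] [NormedSpace ℝ E']
  {G : E' → E' →L[ℝ] E' →L[ℝ] ℝ} {F : E → E'} {y : E}

/-- `F` is an immersion near `y` into a space with the metric `G`. -/
structure IsImmersionAt (G : E' → E' →L[ℝ] E' →L[ℝ] ℝ) (F : E → E') (y : E) : Prop where
  metric : IsMetricAt G (F y)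
  contDiffAt : ContDiffAt ℝ 3 F y
  injective : ∀ᶠ z in 𝓝 y, Function.Injective (fderiv ℝ F z)

theorem inducedMetric_apply (y u v : E) :
    inducedMetric G F y u v = G (F y) (fderiv ℝ F y u) (fderiv ℝ F y v) := rfl

theorem IsImmersionAt.eventually (h : IsImmersionAt G F y) : ∀ᶠ z in 𝓝 y, IsImmersionAt G F z := by
  filter_upwards [h.contDiffAt.continuousAt.eventually h.metric.eventually,
    h.contDiffAt.eventually (by simp), h.injective.eventually_nhds] with z h1 h2 h3
  exact ⟨h1, h2, h3⟩

theorem IsImmersionAt.contDiffAt_fderiv_apply (h : IsImmersionAt G F y) (u : E) :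
    ContDiffAt ℝ 2 (fun z => fderiv ℝ F z u) y :=
  contDiffAt_fderiv_apply_const h.contDiffAt (by norm_num) u

theorem IsImmersionAt.isInnerProduct (h : IsImmersionAt G F y) :
    IsInnerProduct (inducedMetric G F y) where
  symm _ _ := h.metric.self.symm _ _
  pos _ hu := h.metric.self.pos _ fun h0 =>
    hu (h.injective.self_of_nhds (h0.trans (map_zero _).symm))

theorem IsImmersionAt.contDiffAt_fderiv (h : IsImmersionAt G F y) :
    ContDiffAt ℝ 2 (fderiv ℝ F) y := h.contDiffAt.fderiv_right (by norm_num)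

theorem IsImmersionAt.contDiffAt_metric (h : IsImmersionAt G F y) :
    ContDiffAt ℝ 2 (fun z => G (F z)) y :=
  h.metric.contDiffAt.comp y (h.contDiffAt.of_le (by norm_num))

theorem IsImmersionAt.isMetricAt (h : IsImmersionAt G F y) :
    IsMetricAt (inducedMetric G F) y where
  contDiffAt := by
    have h1 := h.contDiffAt_metric.clm_comp h.contDiffAt_fderiv
    have h2 := ((ContinuousLinearMap.flipₗᵢ ℝ E E' ℝ).contDiff.contDiffAt.comp y h1).clm_comp
      h.contDiffAt_fderiv
    exact (ContinuousLinearMap.flipₗᵢ ℝ E E ℝ).contDiff.contDiffAt.comp y h2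
  inner := h.eventually.mono fun _ hz => hz.isInnerProduct

variable [FiniteDimensional ℝ E]

/-- The tangential component of a vector at `F y`, as a vector at `y`. -/
noncomputable def tangentPart (G : E' → E' →L[ℝ] E' →L[ℝ] ℝ) (F : E → E') (y : E) (w : E') : E :=
  (inducedMetric G F y).inverse ((G (F y) w).comp (fderiv ℝ F y))

theorem normalPart_eq (y : E) (w : E') :
    normalPart G F y w = w - fderiv ℝ F y (tangentPart G F y w) := rfl

theorem IsImmersionAt.inducedMetric_tangentPart (h : IsImmersionAt G F y) (w : E') (z : E) :
    inducedMetric G F y (tangentPart G F y w) z = G (F y) w (fderiv ℝ F y z) := by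
  rw [tangentPart, h.isInnerProduct.apply_inverse]
  rfl

theorem IsImmersionAt.tangentPart_eq (h : IsImmersionAt G F y) {w : E'} {t : E}
    (ht : ∀ z, inducedMetric G F y t z = G (F y) w (fderiv ℝ F y z)) : tangentPart G F y w = t :=
  h.isInnerProduct.ext fun z => by rw [h.inducedMetric_tangentPart, ht]

theorem IsImmersionAt.normalPart_apply_fderiv (h : IsImmersionAt G F y) (w : E') (z : E) :
    G (F y) (normalPart G F y w) (fderiv ℝ F y z) = 0 := by
  rw [normalPart_eq, map_sub, sub_apply, ← inducedMetric_apply,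
    h.inducedMetric_tangentPart, sub_self]

/-- Against a normal vector the projection is invisible, so the outer normal derivatives in `R^⊥`
may be replaced by full ones. -/
theorem normalPart_apply_of_normal (w : E') {η : E'} (hη : ∀ z, G (F y) (fderiv ℝ F y z) η = 0) :
    G (F y) (normalPart G F y w) η = G (F y) w η := by
  rw [normalPart_eq, map_sub, sub_apply, hη, sub_zero]

theorem IsImmersionAt.normalPart_eq_self (h : IsImmersionAt G F y) {w : E'}
    (hw : ∀ z, G (F y) w (fderiv ℝ F y z) = 0) : normalPart G F y w = w := by
  rw [normalPart_eq, h.tangentPart_eq (t := 0) fun z => by simp [hw], map_zero, sub_zero]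

theorem IsImmersionAt.contDiffAt_tangentPart (h : IsImmersionAt G F y) {V : E → E'} {k : ℕ∞ω}
    (hk : k ≤ 2) (hV : ContDiffAt ℝ k V y) :
    ContDiffAt ℝ k (fun z => tangentPart G F z (V z)) y :=
  (h.isMetricAt.contDiffAt_inverse.of_le hk).clm_apply
    (((h.contDiffAt_metric.of_le hk).clm_apply hV).clm_comp (h.contDiffAt_fderiv.of_le hk))

theorem IsImmersionAt.contDiffAt_normalPart (h : IsImmersionAt G F y) {V : E → E'} {k : ℕ∞ω}
    (hk : k ≤ 2) (hV : ContDiffAt ℝ k V y) :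
    ContDiffAt ℝ k (fun z => normalPart G F z (V z)) y :=
  hV.sub ((h.contDiffAt_fderiv.of_le hk).clm_apply (h.contDiffAt_tangentPart hk hV))

variable [FiniteDimensional ℝ E']

/-- The covariant derivative of a coordinate tangent field. -/
noncomputable def covDerivFrame (G : E' → E' →L[ℝ] E' →L[ℝ] ℝ) (F : E → E') (u w : E) : E → E' :=
  covDerivAlong G F (fun _ => u) (fun z => fderiv ℝ F z w)

/-- The second fundamental form on coordinate fields. -/
noncomputable def sff (G : E' → E' →L[ℝ] E' →L[ℝ] ℝ) (F : E → E') (u w : E) : E → E' :=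
  secondFundForm G F (fun _ => u) (fun _ => w)

theorem IsImmersionAt.covDerivFrame_symm (h : IsImmersionAt G F y) (u v : E) :
    covDerivFrame G F u v y = covDerivFrame G F v u y :=
  covDerivAlong_fderiv_symm h.metric (h.contDiffAt.of_le (by norm_num)) u v

/-- The Levi-Civita connection of the induced metric is the tangential part of the ambient one. -/
theorem IsImmersionAt.tangentPart_covDerivFrame (h : IsImmersionAt G F y) (u w : E) :
    tangentPart G F y (covDerivFrame G F u w y) = christoffelMap (inducedMetric G F) y u w := by
  refine h.tangentPart_eq fun z => ?_
  have hF : DifferentiableAt ℝ F y := h.contDiffAt.differentiableAt (by simp)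
  have hd : ∀ u : E, DifferentiableAt ℝ (fun z => fderiv ℝ F z u) y := fun u =>
    (h.contDiffAt_fderiv_apply u).differentiableAt (by simp)
  have key : ∀ a b c : E, fderiv ℝ (inducedMetric G F) y a b c =
      G (F y) (covDerivFrame G F a b y) (fderiv ℝ F y c) +
        G (F y) (fderiv ℝ F y b) (covDerivFrame G F a c y) := fun a b c => by
    rw [← fderiv_apply_apply h.isMetricAt.differentiableAt]
    exact fderiv_inner_along h.metric hF (hd b) (hd c) a
  -- The Koszul formula for the induced metric: after the ambient connection's symmetry is used,
  -- only `⟨∇_u F_* w, F_* z⟩` survives.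
  rw [h.isMetricAt.apply_christoffelMap, key, key, key, h.covDerivFrame_symm w u,
    h.covDerivFrame_symm z u, h.covDerivFrame_symm z w,
    h.metric.self.symm (fderiv ℝ F y w), h.metric.self.symm (fderiv ℝ F y u)]
  ring

theorem IsImmersionAt.covDerivFrame_eq (h : IsImmersionAt G F y) (u w : E) :
    covDerivFrame G F u w y =
      fderiv ℝ F y (christoffelMap (inducedMetric G F) y u w) + sff G F u w y := by
  rw [← h.tangentPart_covDerivFrame, sff, secondFundForm, normalPart_eq, covDerivFrame]
  abel

theorem IsImmersionAt.sff_normal (h : IsImmersionAt G F y) (u w z : E) :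
    G (F y) (sff G F u w y) (fderiv ℝ F y z) = 0 :=
  h.normalPart_apply_fderiv _ z

theorem IsImmersionAt.sff_symm (h : IsImmersionAt G F y) (u w : E) :
    sff G F u w y = sff G F w u y := by
  have h1 := h.covDerivFrame_eq u w
  rw [h.covDerivFrame_symm, h.covDerivFrame_eq, h.isMetricAt.christoffelMap_symm] at h1
  exact (add_left_cancel h1).symm

/-- The Gauss formula writes `sff` by means of the Hessian of `F` and two Christoffel maps, each
linear in the second argument. -/
theorem IsImmersionAt.sff_sum_smul (h : IsImmersionAt G F y) (u : E) {ι : Type*} [Fintype ι]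
    (c : ι → ℝ) (e : ι → E) : sff G F u (∑ i, c i • e i) y = ∑ i, c i • sff G F u (e i) y := by
  have h2 : ∀ w, sff G F u w y = fderiv ℝ (fderiv ℝ F) y u w
      + christoffelMap G (F y) (fderiv ℝ F y u) (fderiv ℝ F y w)
      - fderiv ℝ F y (christoffelMap (inducedMetric G F) y u w) := fun w => by
    rw [← fderiv_fderiv_apply (h.contDiffAt.of_le (by norm_num)), eq_sub_iff_add_eq, add_comm,
      ← h.covDerivFrame_eq]
    rfl
  simp only [h2, map_sum, map_smul, smul_sub, smul_add, Finset.sum_add_distrib,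
    Finset.sum_sub_distrib]

theorem IsImmersionAt.contDiffAt_sff (h : IsImmersionAt G F y) (u w : E) :
    ContDiffAt ℝ 1 (sff G F u w) y :=
  h.contDiffAt_normalPart (by norm_num)
    (contDiffAt_covDerivAlong h.metric (h.contDiffAt.of_le (by norm_num))
      (h.contDiffAt_fderiv_apply w) u)

/-- The Gauss formula for a tangent field with variable coordinates, needed because second covariant
derivatives produce such fields. -/
theorem IsImmersionAt.covDerivAlong_fderiv_apply (h : IsImmersionAt G F y) {P : E → E}
    (hP : DifferentiableAt ℝ P y) (u : E) :
    covDerivAlong G F (fun _ => u) (fun z => fderiv ℝ F z (P z)) y =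
      fderiv ℝ F y (fderiv ℝ P y u + christoffelMap (inducedMetric G F) y u (P y))
        + sff G F u (P y) y := by
  have h1 : DifferentiableAt ℝ (fderiv ℝ F) y := h.contDiffAt_fderiv.differentiableAt (by simp)
  have h2 := (h1.hasFDerivAt.clm_apply hP.hasFDerivAt).fderiv
  have h3 := h.covDerivFrame_eq u (P y)
  rw [covDerivFrame, covDerivAlong_const,
    fderiv_fderiv_apply (h.contDiffAt.of_le (by norm_num))] at h3
  rw [covDerivAlong_const, h2, map_add, add_assoc, ← h3]
  simp
  abel

/-- The Weingarten formula, from differentiating `⟨V, F_* w⟩ = 0`; normality is therefore required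
in a neighbourhood. -/
theorem IsImmersionAt.apply_covDerivAlong_of_normal (h : IsImmersionAt G F y) {V : E → E'}
    (hV : DifferentiableAt ℝ V y)
    (hn : ∀ᶠ z in 𝓝 y, ∀ t, G (F z) (V z) (fderiv ℝ F z t) = 0) (u w : E) :
    G (F y) (covDerivAlong G F (fun _ => u) V y) (fderiv ℝ F y w) =
      - G (F y) (V y) (sff G F u w y) := by
  have h1 := fderiv_inner_along h.metric (h.contDiffAt.differentiableAt (by simp)) hV
    ((h.contDiffAt_fderiv_apply w).differentiableAt (by simp)) u
  have h2 : (fun z => G (F z) (V z) (fderiv ℝ F z w)) =ᶠ[𝓝 y] fun _ => 0 :=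
    hn.mono fun z hz => hz w
  have h3 : covDerivAlong G F (fun _ => u) (fun z => fderiv ℝ F z w) y =
      covDerivFrame G F u w y := rfl
  rw [h2.fderiv_eq, h3, h.covDerivFrame_eq, map_add, hn.self_of_nhds, zero_add] at h1
  simp at h1
  linarith

/-- The Gauss equation. -/
theorem IsImmersionAt.gauss (h : IsImmersionAt G F y) (u v w z : E) :
    inducedMetric G F y
        (curvature (inducedMetric G F) (fun _ => u) (fun _ => v) (fun _ => w) y) z =
      G (F y) (curvatureAt G (F y) (fderiv ℝ F y u) (fderiv ℝ F y v) (fderiv ℝ F y w))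
          (fderiv ℝ F y z)
        + G (F y) (sff G F v w y) (sff G F u z y) - G (F y) (sff G F u w y) (sff G F v z y) := by
  have hlie : VectorField.lieBracket ℝ (fun _ : E => u) (fun _ : E => v) = fun _ => 0 := by
    ext q
    simp [VectorField.lieBracket]
  have h0 : covDeriv (inducedMetric G F) (fun _ => 0) (fun _ => w) y = 0 := by
    rw [covDeriv_const]; simp
  have hc := covDerivAlong_commutator h.metric (h.contDiffAt.of_le (by norm_num))
    (h.contDiffAt_fderiv_apply w) u v
  -- `∇_v F_* w` is split by the Gauss formula near `y`. Under `∇_u` its tangential part gives the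
  -- intrinsic second derivative, and its normal part gives the quadratic term by Weingarten.
  have key : ∀ u v : E, G (F y) (covDerivAlong G F (fun _ => u) (covDerivFrame G F v w) y)
      (fderiv ℝ F y z) =
      inducedMetric G F y
        (covDeriv (inducedMetric G F) (fun _ => u)
          (covDeriv (inducedMetric G F) (fun _ => v) (fun _ => w)) y) z
        - G (F y) (sff G F v w y) (sff G F u z y) := fun u v => by
    have h1 : covDerivFrame G F v w =ᶠ[𝓝 y] fun q =>
        fderiv ℝ F q (covDeriv (inducedMetric G F) (fun _ => v) (fun _ => w) q)
          + sff G F v w q := by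
      filter_upwards [h.eventually] with q hq
      rw [hq.covDerivFrame_eq, covDeriv_const]
      simp
    have hP : DifferentiableAt ℝ (covDeriv (inducedMetric G F) (fun _ => v) (fun _ => w)) y := by
      have : ContDiffAt ℝ 1 (fun q => christoffelMap (inducedMetric G F) q v w) y :=
        (h.isMetricAt.contDiffAt_christoffelMap.clm_apply contDiffAt_const).clm_apply
          contDiffAt_const
      refine (this.differentiableAt (by simp)).congr_of_eventuallyEq
        (Eventually.of_forall fun q => ?_)
      simp [covDeriv_const]
    have hd1 : DifferentiableAt ℝ (fun q =>
        fderiv ℝ F q (covDeriv (inducedMetric G F) (fun _ => v) (fun _ => w) q)) y :=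
      (h.contDiffAt_fderiv.differentiableAt (by simp)).clm_apply hP
    have hd2 : DifferentiableAt ℝ (sff G F v w) y :=
      (h.contDiffAt_sff v w).differentiableAt (by simp)
    rw [covDerivAlong_congr h1, covDerivAlong_add hd1 hd2, h.covDerivAlong_fderiv_apply hP,
      ← covDeriv_const, map_add, map_add, add_apply, add_apply, h.sff_normal,
      h.apply_covDerivAlong_of_normal hd2 (h.eventually.mono fun q hq t => hq.sff_normal _ _ t),
      inducedMetric_apply]
    ring
  have hk := congrArg (fun t => G (F y) t (fderiv ℝ F y z)) hc
  simp only [map_sub, sub_apply] at hk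
  have hku := key u v
  have hkv := key v u
  simp only [covDerivFrame] at hku hkv
  rw [curvature, hlie, h0, sub_zero, map_sub, sub_apply, ← hk, hku, hkv]
  ring

/-- The Ricci equation. -/
theorem IsImmersionAt.ricci (h : IsImmersionAt G F y) {ι : Type*} [Fintype ι] [DecidableEq ι]
    {e : ι → E} (he : ∀ i j, inducedMetric G F y (e i) (e j) = if i = j then 1 else 0)
    (hcard : Fintype.card ι = Module.finrank ℝ E) (u v : E) {V : E → E'}
    (hV : ContDiffAt ℝ 2 V y) (hn : ∀ᶠ z in 𝓝 y, ∀ t, G (F z) (V z) (fderiv ℝ F z t) = 0)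
    {η : E'} (hη : ∀ z, G (F y) (fderiv ℝ F y z) η = 0) :
    G (F y) (normalCurvature G F (fun _ => u) (fun _ => v) V y) η =
      G (F y) (curvatureAt G (F y) (fderiv ℝ F y u) (fderiv ℝ F y v) (V y)) η
        + ∑ k, G (F y) (V y) (sff G F v (e k) y) * G (F y) (sff G F u (e k) y) η
        - ∑ k, G (F y) (V y) (sff G F u (e k) y) * G (F y) (sff G F v (e k) y) η := by
  have hlie : VectorField.lieBracket ℝ (fun _ : E => u) (fun _ : E => v) = fun _ => 0 := by
    ext q
    simp [VectorField.lieBracket]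
  have h0 : G (F y) (normalCovDeriv G F (fun _ => 0) V y) η = 0 := by
    rw [normalCovDeriv, normalPart_apply_of_normal _ hη, covDerivAlong_const]
    simp
  have hc := covDerivAlong_commutator h.metric (h.contDiffAt.of_le (by norm_num)) hV u v
  have hV1 : DifferentiableAt ℝ V y := hV.differentiableAt (by simp)
  have key : ∀ u v : E, G (F y) (normalCovDeriv G F (fun _ => u)
      (normalCovDeriv G F (fun _ => v) V) y) η =
      G (F y) (covDerivAlong G F (fun _ => u) (covDerivAlong G F (fun _ => v) V) y) η
        + ∑ k, G (F y) (V y) (sff G F v (e k) y) * G (F y) (sff G F u (e k) y) η := fun u v => by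
    have hD : ContDiffAt ℝ 1 (covDerivAlong G F (fun _ => v) V) y :=
      contDiffAt_covDerivAlong h.metric (h.contDiffAt.of_le (by norm_num)) hV v
    have hT : DifferentiableAt ℝ
        (fun z => tangentPart G F z (covDerivAlong G F (fun _ => v) V z)) y :=
      (h.contDiffAt_tangentPart (by norm_num) hD).differentiableAt (by simp)
    have hd : DifferentiableAt ℝ (fun z => fderiv ℝ F z
        (tangentPart G F z (covDerivAlong G F (fun _ => v) V z))) y :=
      (h.contDiffAt_fderiv.differentiableAt (by simp)).clm_apply hT
    have hsplit : normalCovDeriv G F (fun _ => v) V = fun z =>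
        covDerivAlong G F (fun _ => v) V z -
          fderiv ℝ F z (tangentPart G F z (covDerivAlong G F (fun _ => v) V z)) := rfl
    -- By Weingarten the tangential part removed by `∇^⊥_v` has coefficients `-⟨V, h(v, e k)⟩`; its
    -- derivative re-enters the normal space through `h(u, e k)`.
    have hexp : tangentPart G F y (covDerivAlong G F (fun _ => v) V y) =
        ∑ k, (- G (F y) (V y) (sff G F v (e k) y)) • e k := by
      rw [← sum_apply_smul_of_orthonormal he hcard
        (tangentPart G F y (covDerivAlong G F (fun _ => v) V y))]
      refine Finset.sum_congr rfl fun k _ => ?_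
      rw [h.inducedMetric_tangentPart, h.apply_covDerivAlong_of_normal hV1 hn]
    rw [hsplit, normalCovDeriv, normalPart_apply_of_normal _ hη,
      covDerivAlong_sub (hD.differentiableAt (by simp)) hd, h.covDerivAlong_fderiv_apply hT,
      hexp, h.sff_sum_smul, map_sub, map_add, sub_apply, add_apply, hη, zero_add, map_sum]
    simp [sub_eq_add_neg]
  rw [normalCurvature, hlie, map_sub, map_sub, sub_apply, sub_apply, h0, sub_zero, key u v,
    key v u, ← hc, map_sub, sub_apply]
  ring

end Immersions

end SubmanifoldGeometry

namespace SubmanifoldGeometry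

set_option maxSynthPendingDepth 3
set_option linter.unusedSectionVars false

open Filter Topology

/-! ### Curvature symmetries and the tensor of constant curvature. -/

section CurvatureTensors

/-- A curvature-like tensor whose sectional curvatures vanish is zero. -/
theorem eq_zero_of_sectional_eq_zero {E : Type*} [AddCommGroup E] {T : E → E → E → E → ℝ}
    (add₁ : ∀ a a' b c d, T (a + a') b c d = T a b c d + T a' b c d)
    (add₂ : ∀ a b b' c d, T a (b + b') c d = T a b c d + T a b' c d)
    (add₃ : ∀ a b c c' d, T a b (c + c') d = T a b c d + T a b c' d)
    (add₄ : ∀ a b c d d', T a b c (d + d') = T a b c d + T a b c d')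
    (anti₁₂ : ∀ a b c d, T a b c d = - T b a c d) (anti₃₄ : ∀ a b c d, T a b c d = - T a b d c)
    (bianchi : ∀ a b c d, T a b c d + T b c a d + T c a b d = 0)
    (sec : ∀ a b, T a b b a = 0) (a b c d : E) : T a b c d = 0 := by
  -- Pair symmetry, from four Bianchi identities and the two antisymmetries.
  have pair : ∀ a b c d, T a b c d = T c d a b := fun a b c d => by
    linarith [bianchi a b c d, bianchi b c d a, bianchi c d a b, bianchi d a b c,
      anti₃₄ a b c d, anti₃₄ b c a d, anti₃₄ c a b d, anti₃₄ b c d a, anti₃₄ c d b a,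
      anti₃₄ d b c a, anti₃₄ c d a b, anti₃₄ d a c b, anti₃₄ a c d b, anti₃₄ d a b c,
      anti₃₄ a b d c, anti₃₄ b d a c, anti₁₂ a c b d, anti₁₂ c a b d, anti₁₂ b d a c,
      anti₁₂ d b a c, anti₁₂ a c d b, anti₁₂ b d c a, anti₁₂ c d a b, anti₁₂ a b c d]
  -- Polarization in the outer arguments, then in the middle ones for `h2`. The three terms of the
  -- Bianchi identity then coincide, so `3 T = 0`.
  have h1 : ∀ a b d, T a b b d = 0 := fun a b d => by
    have := sec (a + d) b
    rw [add₁, add₄, add₄, sec, sec] at this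
    linarith [pair d b b a, anti₁₂ b a d b, anti₃₄ a b d b]
  have h2 : ∀ a b c d, T a b c d = - T a c b d := fun a b c d => by
    have := h1 a (b + c) d
    rw [add₂, add₃, add₃, h1, h1] at this
    linarith
  linarith [bianchi a b c d, h2 b c a d, anti₁₂ b a c d, anti₁₂ c a b d, h2 a c b d]

variable {E : Type*} [NormedAddCommGroup E] [NormedSpace ℝ E] [FiniteDimensional ℝ E]
  {G : E → E →L[ℝ] E →L[ℝ] ℝ} {p : E}

theorem curvatureAt_antisymm (a b c : E) : curvatureAt G p a b c = - curvatureAt G p b a c := by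
  simp only [curvatureAt]
  abel

theorem curvatureAt_smul_left (t : ℝ) (a b c : E) :
    curvatureAt G p (t • a) b c = t • curvatureAt G p a b c := by
  simp [curvatureAt, smul_sub, smul_add]

theorem IsMetricAt.fderiv_christoffelMap_symm (h : IsMetricAt G p) (a b c : E) :
    fderiv ℝ (christoffelMap G) p a b c = fderiv ℝ (christoffelMap G) p a c b := by
  have hd : DifferentiableAt ℝ (christoffelMap G) p :=
    h.contDiffAt_christoffelMap.differentiableAt (by simp)
  have key : ∀ b c, fderiv ℝ (christoffelMap G) p a b c =
      fderiv ℝ (fun q => christoffelMap G q b c) p a := fun b c => by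
    rw [((hd.hasFDerivAt.clm_apply (hasFDerivAt_const b p)).clm_apply
      (hasFDerivAt_const c p)).fderiv]
    simp
  have heq : (fun q => christoffelMap G q b c) =ᶠ[𝓝 p] fun q => christoffelMap G q c b :=
    h.eventually.mono fun q hq => hq.christoffelMap_symm b c
  rw [key, key, heq.fderiv_eq]

theorem IsMetricAt.curvatureAt_bianchi (h : IsMetricAt G p) (a b c : E) :
    curvatureAt G p a b c + curvatureAt G p b c a + curvatureAt G p c a b = 0 := by
  simp only [curvatureAt]
  rw [h.fderiv_christoffelMap_symm b c a, h.fderiv_christoffelMap_symm c b a,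
    h.fderiv_christoffelMap_symm a c b, h.christoffelMap_symm c a, h.christoffelMap_symm c b,
    h.christoffelMap_symm b a]
  abel

/-- The second derivative of `⟨c, d⟩`, for constant fields, is symmetric. Expanded by metric
compatibility, its mixed terms cancel on antisymmetrization and `⟨R c, d⟩ + ⟨c, R d⟩ = 0` remains.
-/
theorem IsMetricAt.curvatureAt_skew (h : IsMetricAt G p) (a b c d : E) :
    G p (curvatureAt G p a b c) d = - G p (curvatureAt G p a b d) c := by
  have hf : ContDiffAt ℝ 2 (fun q => G q c d) p :=
    (h.contDiffAt.clm_apply contDiffAt_const).clm_apply contDiffAt_const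
  have hC : ∀ b c : E, DifferentiableAt ℝ
      (covDerivAlong G (fun q : E => q) (fun _ => b) (fun _ => c)) p := fun b c =>
    (contDiffAt_covDerivAlong (F := fun q : E => q) (V := fun _ => c) h contDiffAt_id
      contDiffAt_const b).differentiableAt (by simp)
  have hcurv := fun c => covDerivAlong_commutator (F := fun q : E => q) (V := fun _ => c) (y := p) h
    contDiffAt_id contDiffAt_const a b
  simp only [fderiv_fun_id, ContinuousLinearMap.id_apply] at hcurv
  have key : ∀ a b : E, fderiv ℝ (fderiv ℝ (fun q => G q c d)) p a b =
      G p (covDerivAlong G (fun q : E => q) (fun _ => a)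
        (covDerivAlong G (fun q : E => q) (fun _ => b) (fun _ => c)) p) d +
      G p (covDerivAlong G (fun q : E => q) (fun _ => b) (fun _ => c) p)
        (covDerivAlong G (fun q : E => q) (fun _ => a) (fun _ => d) p) +
      (G p (covDerivAlong G (fun q : E => q) (fun _ => a) (fun _ => c) p)
        (covDerivAlong G (fun q : E => q) (fun _ => b) (fun _ => d) p) +
      G p c (covDerivAlong G (fun q : E => q) (fun _ => a)
        (covDerivAlong G (fun q : E => q) (fun _ => b) (fun _ => d)) p)) := fun a b => by
    have heq : (fun z => fderiv ℝ (fun q => G q c d) z b) =ᶠ[𝓝 p] fun z =>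
        G z (covDerivAlong G (fun q : E => q) (fun _ => b) (fun _ => c) z) d +
        G z c (covDerivAlong G (fun q : E => q) (fun _ => b) (fun _ => d) z) := by
      filter_upwards [h.eventually] with z hz
      exact fderiv_inner_along (F := fun q : E => q) (V := fun _ => c) (W := fun _ => d) hz
        differentiableAt_id (differentiableAt_const _) (differentiableAt_const _) b
    have hd := h.differentiableAt
    rw [← fderiv_fderiv_apply hf, heq.fderiv_eq, fderiv_fun_add
      ((hd.clm_apply (hC b c)).clm_apply (differentiableAt_const _))
      ((hd.clm_apply (differentiableAt_const _)).clm_apply (hC b d)), add_apply]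
    congr 1
    · exact fderiv_inner_along (F := fun q : E => q) (W := fun _ => d) h
        differentiableAt_id (hC b c) (differentiableAt_const _) a
    · exact fderiv_inner_along (F := fun q : E => q) (V := fun _ => c) h
        differentiableAt_id (differentiableAt_const _) (hC b d) a
  have hs := fderiv_fderiv_symm hf a b
  rw [key, key] at hs
  rw [← hcurv c, ← hcurv d, h.self.symm _ c, map_sub, map_sub, sub_apply]
  rw [h.self.symm _ d, h.self.symm _ d] at *
  linarith

theorem IsInnerProduct.gram_pos {B : E →L[ℝ] E →L[ℝ] ℝ} (hB : IsInnerProduct B) {a b : E}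
    (h : LinearIndependent ℝ ![a, b]) : 0 < B a a * B b b - B a b ^ 2 := by
  have ha : a ≠ 0 := h.ne_zero 0
  -- The coefficient is that of the orthogonal projection of `b` to the line of `a`; the remainder
  -- has positive norm.
  have h1 := (LinearIndependent.pair_iff' ha).1 h (B a b / B a a)
  have h2 := hB.pos _ (sub_ne_zero.2 h1)
  have h3 := hB.pos a ha
  simp only [map_sub, map_smul, sub_apply, smul_apply, smul_eq_mul, hB.symm b a] at h2
  have h4 : B a b / B a a * (B a b / B a a * B a a) - B a b / B a a * B a b
      - (B a b / B a a * B a b - B b b) = (B a a * B b b - B a b ^ 2) / B a a := by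
    field_simp
    ring
  have h5 : 0 < (B a a * B b b - B a b ^ 2) / B a a := by
    rw [← h4]; linarith
  exact (div_pos_iff_of_pos_right h3).1 h5

/-- The curvature tensor of a metric of constant sectional curvature. -/
theorem IsMetricAt.curvatureAt_eq_of_constant (h : IsMetricAt G p) {κ : ℝ}
    (hκ : ∀ a b, LinearIndependent ℝ ![a, b] →
      G p (curvatureAt G p a b b) a / (G p a a * G p b b - G p a b ^ 2) = κ) (a b c d : E) :
    G p (curvatureAt G p a b c) d = κ * (G p b c * G p a d - G p a c * G p b d) := by
  have hself : ∀ a c : E, curvatureAt G p a a c = 0 := fun a c => by simp [curvatureAt]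
  have hsec : ∀ a b, G p (curvatureAt G p a b b) a = κ * (G p b b * G p a a - G p a b * G p b a) := by
    intro a b
    by_cases hli : LinearIndependent ℝ ![a, b]
    · have h1 := hκ a b hli
      rw [div_eq_iff (h.self.gram_pos hli).ne'] at h1
      rw [h1, h.self.symm b a]
      ring
    · rcases eq_or_ne a 0 with rfl | ha
      · simp
      · rw [LinearIndependent.pair_iff' ha] at hli
        push Not at hli
        obtain ⟨t, rfl⟩ := hli
        rw [curvatureAt_antisymm, curvatureAt_smul_left, hself]
        simp
        ring_nf
        simp
  -- The difference from the model tensor has all curvature symmetries and vanishing sectional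
  -- values, dependent pairs included.
  refine sub_eq_zero.1 (eq_zero_of_sectional_eq_zero (T := fun a b c d =>
    G p (curvatureAt G p a b c) d - κ * (G p b c * G p a d - G p a c * G p b d))
    ?_ ?_ ?_ ?_ ?_ ?_ ?_ ?_ a b c d)
  · intro a a' b c d; simp [curvatureAt]; ring
  · intro a b b' c d; simp [curvatureAt]; ring
  · intro a b c c' d; simp [curvatureAt]; ring
  · intro a b c d d'; simp; ring
  · intro a b c d
    rw [curvatureAt_antisymm]; simp; ring
  · intro a b c d
    rw [h.curvatureAt_skew]; ring
  · intro a b c d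
    have := congrArg (fun t => G p t d) (h.curvatureAt_bianchi a b c)
    simp only [map_add, add_apply, map_zero, zero_apply] at this
    rw [h.self.symm c a, h.self.symm c b, h.self.symm b a]
    linarith
  · intro a b
    rw [hsec, sub_self]

end CurvatureTensors

end SubmanifoldGeometry

namespace SubmanifoldGeometry

set_option maxSynthPendingDepth 3
set_option linter.unusedSectionVars false

open Filter Topology Bundle

/-! ### Riemannian metrics read in charts. -/

section Charts

variable {d : ℕ} {M : Type*} [TopologicalSpace M] [ChartedSpace (EuclideanSpace ℝ (Fin d)) M]
  [IsManifold (𝓡 d) ∞ M]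

variable (d) in
/-- The differential at `y` of the preferred chart at `x`. -/
noncomputable def chartDeriv (x y : M) : TangentSpace (𝓡 d) y →L[ℝ] EuclideanSpace ℝ (Fin d) :=
  mfderiv (𝓡 d) 𝓘(ℝ, EuclideanSpace ℝ (Fin d)) (extChartAt (𝓡 d) x) y

theorem coord_eq (x : M) (u : TangentSpace (𝓡 d) x) : coord d x u = chartDeriv d x x u := rfl

theorem chartDeriv_chartInvDeriv (x : M) {y : EuclideanSpace ℝ (Fin d)}
    (hy : y ∈ (extChartAt (𝓡 d) x).target) (w : EuclideanSpace ℝ (Fin d)) :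
    chartDeriv d x ((extChartAt (𝓡 d) x).symm y) (chartInvDeriv d x y w) = w := by
  have h := mfderiv_extChartAt_comp_mfderivWithin_extChartAt_symm (I := 𝓡 d) hy
  simp only [ModelWithCorners.range_eq_univ, mfderivWithin_univ] at h
  exact congrArg (fun L => L w) h

theorem chartInvDeriv_chartDeriv (x : M) {y : EuclideanSpace ℝ (Fin d)}
    (hy : y ∈ (extChartAt (𝓡 d) x).target)
    (w : TangentSpace (𝓡 d) ((extChartAt (𝓡 d) x).symm y)) :
    chartInvDeriv d x y (chartDeriv d x ((extChartAt (𝓡 d) x).symm y) w) = w := by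
  have h := mfderivWithin_extChartAt_symm_comp_mfderiv_extChartAt (I := 𝓡 d) hy
  simp only [ModelWithCorners.range_eq_univ, mfderivWithin_univ] at h
  exact congrArg (fun L => L w) h

theorem metricInChart_apply (g : Metric d M) (x : M) (y u v : EuclideanSpace ℝ (Fin d)) :
    metricInChart g x y u v =
      g.inner ((extChartAt (𝓡 d) x).symm y) (chartInvDeriv d x y u) (chartInvDeriv d x y v) := rfl

theorem isInnerProduct_metricInChart (g : Metric d M) (x : M) {y : EuclideanSpace ℝ (Fin d)}
    (hy : y ∈ (extChartAt (𝓡 d) x).target) : IsInnerProduct (metricInChart g x y) := by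
  constructor
  · intro u v
    rw [metricInChart_apply, metricInChart_apply, g.symm]
  · intro u hu
    rw [metricInChart_apply]
    refine g.pos _ _ fun h0 => hu ?_
    rw [← chartDeriv_chartInvDeriv x hy u, h0, map_zero]

theorem metricInChart_chartDeriv (g : Metric d M) (x : M) {y : M}
    (hy : y ∈ (extChartAt (𝓡 d) x).source) (u v : TangentSpace (𝓡 d) y) :
    metricInChart g x (extChartAt (𝓡 d) x y) (chartDeriv d x y u) (chartDeriv d x y v) =
      g.inner y u v := by
  -- The point is generalized because the tangent spaces at `symm (chart y)` and at `y` are indexed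
  -- by points that are only propositionally equal.
  have key : ∀ (z : M) (_ : (extChartAt (𝓡 d) x).symm (extChartAt (𝓡 d) x y) = z)
      (u v : TangentSpace (𝓡 d) z), metricInChart g x (extChartAt (𝓡 d) x y)
      (chartDeriv d x z u) (chartDeriv d x z v) = g.inner z u v := by
    rintro z rfl u v
    have hy' := (extChartAt (𝓡 d) x).map_source hy
    rw [metricInChart_apply, chartInvDeriv_chartDeriv x hy', chartInvDeriv_chartDeriv x hy']
  exact key y ((extChartAt (𝓡 d) x).left_inv hy) u v

theorem metricInChart_coord (g : Metric d M) (x : M) (u v : TangentSpace (𝓡 d) x) :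
    metricInChart g x (extChartAt (𝓡 d) x x) (coord d x u) (coord d x v) = g.inner x u v :=
  metricInChart_chartDeriv g x (mem_extChartAt_source x) u v

/-- A coordinate field is smooth because the trivialization of the tangent bundle centred at `x`
reads it as the constant `u`. -/
theorem contMDiffAt_chartInvDeriv (x : M) (u : EuclideanSpace ℝ (Fin d)) :
    ContMDiffAt 𝓘(ℝ, EuclideanSpace ℝ (Fin d)) ((𝓡 d).prod 𝓘(ℝ, EuclideanSpace ℝ (Fin d))) ∞
      (fun y => TotalSpace.mk' (EuclideanSpace ℝ (Fin d)) (E := fun z : M => TangentSpace (𝓡 d) z)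
        ((extChartAt (𝓡 d) x).symm y) (chartInvDeriv d x y u)) (extChartAt (𝓡 d) x x) := by
  rw [contMDiffAt_totalSpace]
  constructor
  · exact (contMDiffOn_extChartAt_symm x).contMDiffAt (extChartAt_target_mem_nhds x)
  · refine (contMDiffAt_const (c := u)).congr_of_eventuallyEq ?_
    filter_upwards [extChartAt_target_mem_nhds (I := 𝓡 d) x] with y hy
    have hy' : (extChartAt (𝓡 d) x).symm y ∈ (chartAt (EuclideanSpace ℝ (Fin d)) x).source := by
      rw [← extChartAt_source (𝓡 d)]
      exact (extChartAt (𝓡 d) x).map_target hy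
    have h1 := TangentBundle.continuousLinearMapAt_trivializationAt (I := 𝓡 d) hy'
    have h2 := congrArg (fun L => L (chartInvDeriv d x y u)) h1
    simp only [extChartAt_to_inv]
    refine Eq.trans ?_ (h2.trans (chartDeriv_chartInvDeriv x hy u))
    rw [Trivialization.continuousLinearMapAt_apply, Trivialization.linearMapAt_apply]
    rw [if_pos]
    simpa using hy'

theorem contDiffAt_metricInChart_apply (g : Metric d M) (x : M) (u v : EuclideanSpace ℝ (Fin d)) :
    ContDiffAt ℝ ∞ (fun y => metricInChart g x y u v) (extChartAt (𝓡 d) x x) := by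
  have hb : ContMDiffAt 𝓘(ℝ, EuclideanSpace ℝ (Fin d)) (𝓡 d) ∞ (extChartAt (𝓡 d) x).symm
      (extChartAt (𝓡 d) x x) :=
    (contMDiffOn_extChartAt_symm x).contMDiffAt (extChartAt_target_mem_nhds x)
  have : ContMDiffAt 𝓘(ℝ, EuclideanSpace ℝ (Fin d)) ((𝓡 d).prod 𝓘(ℝ)) ∞
      (fun y => TotalSpace.mk' ℝ (E := Bundle.Trivial M ℝ) ((extChartAt (𝓡 d) x).symm y)
        (g.inner ((extChartAt (𝓡 d) x).symm y) (chartInvDeriv d x y u) (chartInvDeriv d x y v)))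
      (extChartAt (𝓡 d) x x) := by
    apply ContMDiffAt.clm_bundle_apply₂ (F₁ := EuclideanSpace ℝ (Fin d))
      (F₂ := EuclideanSpace ℝ (Fin d))
    · exact g.contMDiff.contMDiffAt.comp (extChartAt (𝓡 d) x x) hb
    · exact contMDiffAt_chartInvDeriv x u
    · exact contMDiffAt_chartInvDeriv x v
  rw [contMDiffAt_totalSpace] at this
  exact this.2.contDiffAt

theorem _root_.contDiffAt_of_forall_clm_apply {D E F : Type*} [NormedAddCommGroup D]
    [NormedSpace ℝ D] [NormedAddCommGroup E] [NormedSpace ℝ E] [NormedAddCommGroup F]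
    [NormedSpace ℝ F] [FiniteDimensional ℝ E] {n : ℕ∞ω} {f : D → E →L[ℝ] F} {p : D}
    (h : ∀ u, ContDiffAt ℝ n (fun y => f y u) p) : ContDiffAt ℝ n f p := by
  let e₁ : E ≃L[ℝ] Fin (Module.finrank ℝ E) → ℝ :=
    ContinuousLinearEquiv.ofFinrankEq (by simp)
  let e₂ := (e₁.arrowCongr (.refl ℝ F)).trans (ContinuousLinearEquiv.piRing (Fin _))
  rw [← Function.id_comp f, ← e₂.symm_comp_self]
  exact e₂.symm.contDiff.contDiffAt.comp p (contDiffAt_pi.2 fun i => h _)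

theorem isMetricAt_metricInChart (g : Metric d M) (x : M) :
    IsMetricAt (metricInChart g x) (extChartAt (𝓡 d) x x) where
  inner := by
    filter_upwards [extChartAt_target_mem_nhds (I := 𝓡 d) x] with y hy
    exact isInnerProduct_metricInChart g x hy
  contDiffAt := contDiffAt_of_forall_clm_apply fun u => contDiffAt_of_forall_clm_apply fun v =>
    by
    exact_mod_cast contDiffAt_infty.1 (contDiffAt_metricInChart_apply g x u v) 2

end Charts

/-! ### Isometric immersions read in charts. -/

section ImmersionsInCharts

variable {n d : ℕ}
  {M : Type*} [TopologicalSpace M] [ChartedSpace (EuclideanSpace ℝ (Fin n)) M]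
  [IsManifold (𝓡 n) ∞ M]
  {N : Type*} [TopologicalSpace N] [ChartedSpace (EuclideanSpace ℝ (Fin d)) N]
  [IsManifold (𝓡 d) ∞ N]
  {gM : Metric n M} {gN : Metric d N} {f : M → N}

theorem writtenInExtChartAt_self (x : M) :
    writtenInExtChartAt (𝓡 n) (𝓡 d) x f (extChartAt (𝓡 n) x x) = extChartAt (𝓡 d) (f x) (f x) := by
  simp [writtenInExtChartAt]

theorem fderiv_writtenInExtChartAt (hf : ContMDiff (𝓡 n) (𝓡 d) ∞ f) (x : M)
    {y : EuclideanSpace ℝ (Fin n)} (hy : y ∈ (extChartAt (𝓡 n) x).target)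
    (hfy : f ((extChartAt (𝓡 n) x).symm y) ∈ (extChartAt (𝓡 d) (f x)).source)
    (u : EuclideanSpace ℝ (Fin n)) :
    fderiv ℝ (writtenInExtChartAt (𝓡 n) (𝓡 d) x f) y u =
      chartDeriv d (f x) (f ((extChartAt (𝓡 n) x).symm y))
        (mfderiv (𝓡 n) (𝓡 d) f ((extChartAt (𝓡 n) x).symm y) (chartInvDeriv n x y u)) := by
  have h1 : MDifferentiableAt 𝓘(ℝ, EuclideanSpace ℝ (Fin n)) (𝓡 n) (extChartAt (𝓡 n) x).symm y := by
    have := mdifferentiableWithinAt_extChartAt_symm (I := 𝓡 n) hy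
    simpa [mdifferentiableWithinAt_univ] using this
  have h2 : MDifferentiableAt (𝓡 n) (𝓡 d) f ((extChartAt (𝓡 n) x).symm y) :=
    hf.mdifferentiableAt (by simp)
  have h3 : MDifferentiableAt (𝓡 d) 𝓘(ℝ, EuclideanSpace ℝ (Fin d)) (extChartAt (𝓡 d) (f x))
      (f ((extChartAt (𝓡 n) x).symm y)) :=
    mdifferentiableAt_extChartAt (by rwa [extChartAt_source] at hfy)
  have h4 := mfderiv_comp y h3 (h2.comp y h1)
  rw [mfderiv_comp y h2 h1] at h4
  have h5 : mfderiv 𝓘(ℝ, EuclideanSpace ℝ (Fin n)) 𝓘(ℝ, EuclideanSpace ℝ (Fin d))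
      (writtenInExtChartAt (𝓡 n) (𝓡 d) x f) y =
      fderiv ℝ (writtenInExtChartAt (𝓡 n) (𝓡 d) x f) y := mfderiv_eq_fderiv
  rw [← h5]
  exact congrArg (fun L => L u) h4

theorem eventually_mem_charts (hf : ContMDiff (𝓡 n) (𝓡 d) ∞ f) (x : M) :
    ∀ᶠ y in 𝓝 (extChartAt (𝓡 n) x x), y ∈ (extChartAt (𝓡 n) x).target ∧
      f ((extChartAt (𝓡 n) x).symm y) ∈ (extChartAt (𝓡 d) (f x)).source := by
  refine Filter.Eventually.and (extChartAt_target_mem_nhds (I := 𝓡 n) x) ?_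
  have hc : ContinuousAt (fun y => f ((extChartAt (𝓡 n) x).symm y)) (extChartAt (𝓡 n) x x) :=
    ContinuousAt.comp hf.continuous.continuousAt (continuousAt_extChartAt_symm x)
  refine hc.eventually_mem ?_
  rw [extChartAt_to_inv]
  exact extChartAt_source_mem_nhds (f x)

/-- Valid near the base point and not only there, so that the two metrics also have the same
curvature. -/
theorem IsIsometricImmersion.inducedMetric_eq (hf : IsIsometricImmersion gM gN f) (x : M)
    {y : EuclideanSpace ℝ (Fin n)} (hy : y ∈ (extChartAt (𝓡 n) x).target)
    (hfy : f ((extChartAt (𝓡 n) x).symm y) ∈ (extChartAt (𝓡 d) (f x)).source) :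
    inducedMetric (metricInChart gN (f x)) (writtenInExtChartAt (𝓡 n) (𝓡 d) x f) y =
      metricInChart gM x y := by
  ext u v
  rw [inducedMetric_apply, fderiv_writtenInExtChartAt hf.1 x hy hfy,
    fderiv_writtenInExtChartAt hf.1 x hy hfy, metricInChart_apply gM, ← hf.2]
  exact metricInChart_chartDeriv gN (f x) hfy _ _

theorem contDiffAt_writtenInExtChartAt (hf : ContMDiff (𝓡 n) (𝓡 d) ∞ f) (x : M) :
    ContDiffAt ℝ ∞ (writtenInExtChartAt (𝓡 n) (𝓡 d) x f) (extChartAt (𝓡 n) x x) := by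
  have := (contMDiffAt_iff.1 (hf.contMDiffAt (x := x))).2
  rwa [ModelWithCorners.range_eq_univ, contDiffWithinAt_univ] at this

theorem IsIsometricImmersion.isImmersionAt (hf : IsIsometricImmersion gM gN f) (x : M) :
    IsImmersionAt (metricInChart gN (f x)) (writtenInExtChartAt (𝓡 n) (𝓡 d) x f)
      (extChartAt (𝓡 n) x x) where
  metric := by
    rw [writtenInExtChartAt_self]
    exact isMetricAt_metricInChart gN (f x)
  contDiffAt := by
    exact_mod_cast contDiffAt_infty.1 (contDiffAt_writtenInExtChartAt hf.1 x) 3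
  injective := by
    filter_upwards [eventually_mem_charts hf.1 x] with y hy
    refine (injective_iff_map_eq_zero _).2 fun u hu => ?_
    by_contra h0
    have := (isInnerProduct_metricInChart gM x hy.1).pos u h0
    rw [← hf.inducedMetric_eq x hy.1 hy.2, inducedMetric_apply, hu] at this
    simp at this

theorem fderiv_writtenInExtChartAt_coord (hf : ContMDiff (𝓡 n) (𝓡 d) ∞ f) (x : M)
    (u : TangentSpace (𝓡 n) x) :
    fderiv ℝ (writtenInExtChartAt (𝓡 n) (𝓡 d) x f) (extChartAt (𝓡 n) x x) (coord n x u) =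
      coord d (f x) (mfderiv (𝓡 n) (𝓡 d) f x u) := by
  have h1 := mfderiv_extChartAt_self (I := 𝓡 n) (x := x)
  have h2 := mfderiv_extChartAt_self (I := 𝓡 d) (x := f x)
  have h3 : MDifferentiableAt (𝓡 n) (𝓡 d) f x := hf.mdifferentiableAt (by simp)
  rw [coord, coord, h1, h2, h3.mfderiv, ModelWithCorners.range_eq_univ, fderivWithin_univ]
  rfl

end ImmersionsInCharts

end SubmanifoldGeometry

namespace SubmanifoldGeometry

/-! ### From the commutator inequality to the scalar curvature inequality. -/

section NormalScalarCurvatureInequality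

theorem sum_Ioi_eq_half {k : ℕ} (f : Fin k → Fin k → ℝ) (hs : ∀ i j, f i j = f j i)
    (hd : ∀ i, f i i = 0) : ∑ i, ∑ j ∈ Finset.Ioi i, f i j = (∑ i, ∑ j, f i j) / 2 := by
  have h1 : ∀ i, ∑ j ∈ Finset.Ioi i, f i j = ∑ j, if i < j then f i j else 0 := fun i => by
    rw [← Finset.sum_filter]
    exact Finset.sum_congr (by ext; simp) fun _ _ => rfl
  have h2 : ∑ i, ∑ j, f i j = ∑ i, ∑ j, (if i < j then f i j else 0) +
      ∑ i, ∑ j, (if j < i then f i j else 0) := by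
    simp only [← Finset.sum_add_distrib]
    refine Finset.sum_congr rfl fun i _ => Finset.sum_congr rfl fun j _ => ?_
    rcases lt_trichotomy i j with h | h | h
    · simp [h, h.not_gt]
    · simp [h, hd]
    · simp [h, h.not_gt]
  have h3 : ∑ i, ∑ j, (if j < i then f i j else 0) = ∑ i, ∑ j, (if i < j then f i j else 0) := by
    rw [Finset.sum_comm]
    exact Finset.sum_congr rfl fun i _ => Finset.sum_congr rfl fun j _ => by rw [hs]
  simp only [h1]
  rw [h2, h3]
  ring

theorem sum_comm_four {α β : Type*} [Fintype α] [Fintype β] (f : α → α → β → β → ℝ) :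
    ∑ r, ∑ s, ∑ i, ∑ j, f r s i j = ∑ i, ∑ j, ∑ r, ∑ s, f r s i j :=
  calc ∑ r, ∑ s, ∑ i, ∑ j, f r s i j
      = ∑ r, ∑ i, ∑ s, ∑ j, f r s i j := Finset.sum_congr rfl fun _ _ => Finset.sum_comm
    _ = ∑ i, ∑ r, ∑ s, ∑ j, f r s i j := Finset.sum_comm
    _ = ∑ i, ∑ r, ∑ j, ∑ s, f r s i j :=
        Finset.sum_congr rfl fun _ _ => Finset.sum_congr rfl fun _ _ => Finset.sum_comm
    _ = ∑ i, ∑ j, ∑ r, ∑ s, f r s i j := Finset.sum_congr rfl fun _ _ => Finset.sum_comm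

variable {n m : ℕ}

/-- Pythagoras: the traceless part is orthogonal to the scalar part, whose squared norm is `trace² /
n`. -/
theorem normSq_sub_smul_one (hn : n ≠ 0) (A : Fin m → Matrix (Fin n) (Fin n) ℝ) :
    normSq (fun r => A r - ((A r).trace / n) • (1 : Matrix (Fin n) (Fin n) ℝ)) =
      normSq A - (∑ r, (A r).trace ^ 2) / n := by
  have hn' : (n : ℝ) ≠ 0 := Nat.cast_ne_zero.2 hn
  have h1 : ∀ B : Matrix (Fin n) (Fin n) ℝ, frob B 1 = B.trace := fun B => by
    simp [frob, Matrix.one_apply, Matrix.trace]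
  have h2 : frob (1 : Matrix (Fin n) (Fin n) ℝ) 1 = n := by rw [h1]; simp
  have h3 : ∀ B : Matrix (Fin n) (Fin n) ℝ,
      frob (B - (B.trace / n) • (1 : Matrix (Fin n) (Fin n) ℝ))
        (B - (B.trace / n) • (1 : Matrix (Fin n) (Fin n) ℝ)) = frob B B - B.trace ^ 2 / n := by
    intro B
    rw [sub_eq_add_neg, ← neg_smul, frob_add_left, frob_add_right, frob_add_right, frob_smul_left,
      frob_smul_left, frob_smul_right, frob_smul_right, frob_comm 1 B, h1, h2]
    field_simp
    ring
  simp only [normSq, h3, Finset.sum_sub_distrib, Finset.sum_div]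

theorem matComm_sub_smul_one (A B : Matrix (Fin n) (Fin n) ℝ) (s t : ℝ) :
    matComm (A - s • 1) (B - t • 1) = matComm A B := by
  simp only [matComm, sub_mul, mul_sub, Matrix.smul_mul, Matrix.mul_smul, Matrix.mul_one,
    Matrix.one_mul, smul_comm s t]
  abel

/-- Restricting to `i < j` and to `r < s` halves the sum twice, since a commutator of symmetric
matrices is skew in both index pairs. -/
theorem sum_matComm_sq (A : Fin m → Matrix (Fin n) (Fin n) ℝ)
    (hA : ∀ r, (A r).transpose = A r) :
    ∑ i, ∑ j ∈ Finset.Ioi i, ∑ r, ∑ s ∈ Finset.Ioi r, matComm (A s) (A r) i j ^ 2 =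
      commSq A / 4 := by
  have hswap : ∀ r s i j, matComm (A s) (A r) i j = - matComm (A r) (A s) i j := fun r s i j => by
    simp [matComm]
  have hskew : ∀ r s i j, matComm (A s) (A r) i j = - matComm (A s) (A r) j i := fun r s i j => by
    have : (matComm (A s) (A r)).transpose = matComm (A r) (A s) := by
      simp [matComm, hA]
    rw [hswap, ← this, Matrix.transpose_apply]
  have h1 : ∀ i j, ∑ r, ∑ s ∈ Finset.Ioi r, matComm (A s) (A r) i j ^ 2 =
      (∑ r, ∑ s, matComm (A s) (A r) i j ^ 2) / 2 := fun i j =>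
    sum_Ioi_eq_half (fun r s => matComm (A s) (A r) i j ^ 2)
      (fun r s => by rw [hswap, neg_sq]) (fun r => by simp [matComm])
  simp only [h1]
  rw [sum_Ioi_eq_half (fun i j => (∑ r, ∑ s, matComm (A s) (A r) i j ^ 2) / 2)
    (fun i j => congrArg (· / 2) <| Finset.sum_congr rfl fun r _ =>
      Finset.sum_congr rfl fun s _ => by rw [hskew, neg_sq])
    (fun i => by
      have : ∀ r s, matComm (A s) (A r) i i = 0 := fun r s => by linarith [hskew r s i i]
      simp [this])]
  have h2 : commSq A = ∑ i, ∑ j, ∑ r, ∑ s, matComm (A s) (A r) i j ^ 2 := by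
    simp only [commSq, frob, ← sq]
    rw [Finset.sum_comm]
    exact sum_comm_four fun r s i j => matComm (A s) (A r) i j ^ 2
  rw [h2]
  simp only [← Finset.sum_div]
  ring

/-- The commutator inequality is applied to the traceless parts. The square root is then at most
`(normSq A - T / n) / 2`, while the minors sum to `(T - normSq A) / 2`. Hence `normSq A` cancels,
and `T (1 - 1 / n) / (n (n - 1)) = T / n²` remains. -/
theorem algebraic_normal_scalar_curvature_inequality (hn : 2 ≤ n) (κ : ℝ)
    (A : Fin m → Matrix (Fin n) (Fin n) ℝ) (hA : ∀ r, (A r).transpose = A r) :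
    2 / ((n : ℝ) * ((n : ℝ) - 1)) *
          ∑ i, ∑ j ∈ Finset.Ioi i, (κ + ∑ r, (A r i i * A r j j - A r i j ^ 2)) +
        2 / ((n : ℝ) * ((n : ℝ) - 1)) *
          Real.sqrt (∑ i, ∑ j ∈ Finset.Ioi i, ∑ r, ∑ s ∈ Finset.Ioi r,
            matComm (A s) (A r) i j ^ 2) ≤
      ∑ r, ((A r).trace / n) ^ 2 + κ := by
  have hn2 : (2 : ℝ) ≤ n := by exact_mod_cast hn
  have hn0 : (n : ℝ) ≠ 0 := by positivity
  have hn1 : (n : ℝ) - 1 ≠ 0 := by linarith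
  set T := ∑ r, (A r).trace ^ 2 with hT
  have h1 : Real.sqrt (∑ i, ∑ j ∈ Finset.Ioi i, ∑ r, ∑ s ∈ Finset.Ioi r,
      matComm (A s) (A r) i j ^ 2) ≤ (normSq A - T / n) / 2 := by
    rw [sum_matComm_sq A hA]
    have h := commSq_le_normSq_sq
      (fun r => A r - ((A r).trace / n) • (1 : Matrix (Fin n) (Fin n) ℝ)) fun r => by
        rw [Matrix.transpose_sub, hA, Matrix.transpose_smul, Matrix.transpose_one]
    have h0 := normSq_nonneg
      (fun r => A r - ((A r).trace / n) • (1 : Matrix (Fin n) (Fin n) ℝ))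
    rw [normSq_sub_smul_one (by omega)] at h h0
    have hc : commSq (fun r => A r - ((A r).trace / n) • (1 : Matrix (Fin n) (Fin n) ℝ)) =
        commSq A := by
      simp only [commSq, matComm_sub_smul_one]
    rw [hc] at h
    refine Real.sqrt_le_iff.2 ⟨by linarith, ?_⟩
    nlinarith
  have h2 : ∑ i, ∑ j ∈ Finset.Ioi i, (κ + ∑ r, (A r i i * A r j j - A r i j ^ 2)) =
      κ * (n * (n - 1) / 2) + (T - normSq A) / 2 := by
    simp only [Finset.sum_add_distrib]
    congr 1
    · have h3 : ∀ i : Fin n, ∑ j ∈ Finset.Ioi i, κ =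
          ∑ j ∈ Finset.Ioi i, if i = j then 0 else κ := fun i =>
        Finset.sum_congr rfl fun j hj => by rw [if_neg (Finset.mem_Ioi.1 hj).ne]
      simp only [h3]
      rw [sum_Ioi_eq_half (fun i j => if i = j then 0 else κ) (fun i j => by simp only [eq_comm])
        (fun i => by simp)]
      have h4 : ∀ i j : Fin n, (if i = j then 0 else κ) = κ - if i = j then κ else 0 :=
        fun i j => by split_ifs <;> simp
      simp only [h4, Finset.sum_sub_distrib, Finset.sum_ite_eq, Finset.mem_univ, if_true,
        Finset.sum_const, Finset.card_univ, Fintype.card_fin, nsmul_eq_mul]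
      ring
    · have hsymm : ∀ r i j, A r i j = A r j i := fun r i j => congrFun (congrFun (hA r) j) i
      rw [sum_Ioi_eq_half (fun i j => ∑ r, (A r i i * A r j j - A r i j ^ 2))
        (fun i j => Finset.sum_congr rfl fun r _ => by rw [hsymm r i j]; ring)
        (fun i => Finset.sum_eq_zero fun r _ => by ring)]
      congr 1
      have h5 : ∀ r, ∑ i, ∑ j, (A r i i * A r j j - A r i j ^ 2) =
          (A r).trace ^ 2 - frob (A r) (A r) := fun r => by
        rw [Matrix.trace, sq, Finset.sum_mul_sum]
        simp only [Finset.sum_sub_distrib, frob, ← sq, Matrix.diag]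
      rw [hT, normSq, ← Finset.sum_sub_distrib, ← Finset.sum_congr rfl fun r _ => h5 r]
      exact Eq.trans (Finset.sum_congr rfl fun i _ => Finset.sum_comm) Finset.sum_comm
  rw [h2]
  have hpos : 0 < 2 / ((n : ℝ) * ((n : ℝ) - 1)) := by
    apply div_pos two_pos (mul_pos (by linarith) (by linarith))
  calc _ ≤ 2 / ((n : ℝ) * ((n : ℝ) - 1)) * (κ * (n * (n - 1) / 2) + (T - normSq A) / 2) +
        2 / ((n : ℝ) * ((n : ℝ) - 1)) * ((normSq A - T / n) / 2) := by
        gcongr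
    _ = T / n ^ 2 + κ := by
        field_simp
        ring
    _ = _ := by
        simp only [hT, div_pow, Finset.sum_div]

end NormalScalarCurvatureInequality

end SubmanifoldGeometry

namespace SubmanifoldGeometry

set_option maxSynthPendingDepth 3
set_option linter.unusedSectionVars false

open Filter Topology

theorem curvatureAt_congr {E : Type*} [NormedAddCommGroup E] [NormedSpace ℝ E]
    {G G' : E → E →L[ℝ] E →L[ℝ] ℝ} {p : E} (h : G =ᶠ[𝓝 p] G') :
    curvatureAt G p = curvatureAt G' p := by
  have h1 : christoffelMap G =ᶠ[𝓝 p] christoffelMap G' := by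
    filter_upwards [h, h.fderiv (𝕜 := ℝ)] with q h2 h3
    rw [christoffelMap, christoffelMap, h2, h3]
  ext a b c
  rw [curvatureAt, curvatureAt, h1.fderiv_eq, h1.eq_of_nhds]

/-! ### The ambient curvature tensor in a chart. -/

section SpaceForms

variable {d : ℕ} {N : Type*} [TopologicalSpace N] [ChartedSpace (EuclideanSpace ℝ (Fin d)) N]
  [IsManifold (𝓡 d) ∞ N] {g : Metric d N}

/-- The preferred chart at `x` has identity differential at `x`, the tangent space being the model
space. -/
theorem coord_surjective (x : N) (a : EuclideanSpace ℝ (Fin d)) : ∃ u, coord d x u = a := by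
  refine ⟨a, ?_⟩
  exact congrArg (fun L => L a) (mfderiv_extChartAt_self (I := 𝓡 d) (x := x))

theorem riemannTensor_eq (x : N) (u v w z : TangentSpace (𝓡 d) x) :
    riemannTensor g x u v w z = metricInChart g x (extChartAt (𝓡 d) x x)
      (curvatureAt (metricInChart g x) (extChartAt (𝓡 d) x x) (coord d x u) (coord d x v)
        (coord d x w)) (coord d x z) := by
  rw [riemannTensor, curvature_const (isMetricAt_metricInChart g x)]

theorem HasConstantSectionalCurvature.curvatureAt_eq {κ : ℝ}
    (h : HasConstantSectionalCurvature g κ) (x : N) (a b c e : EuclideanSpace ℝ (Fin d)) :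
    metricInChart g x (extChartAt (𝓡 d) x x)
        (curvatureAt (metricInChart g x) (extChartAt (𝓡 d) x x) a b c) e =
      κ * (metricInChart g x (extChartAt (𝓡 d) x x) b c *
          metricInChart g x (extChartAt (𝓡 d) x x) a e -
        metricInChart g x (extChartAt (𝓡 d) x x) a c *
          metricInChart g x (extChartAt (𝓡 d) x x) b e) := by
  refine (isMetricAt_metricInChart g x).curvatureAt_eq_of_constant (fun a b hab => ?_) a b c e
  obtain ⟨u, rfl⟩ := coord_surjective x a
  obtain ⟨v, rfl⟩ := coord_surjective x b
  have huv : LinearIndependent ℝ ![u, v] := by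
    rw [LinearIndependent.pair_iff] at hab ⊢
    intro s t hst
    refine hab s t ?_
    rw [coord_eq, coord_eq, ← map_smul, ← map_smul, ← map_add, hst, map_zero]
  have h1 := h x u v huv
  rwa [sectionalCurvature, riemannTensor_eq, ← metricInChart_coord g x u u,
    ← metricInChart_coord g x v v, ← metricInChart_coord g x u v] at h1

end SpaceForms

/-! ### Frames adapted to the immersion. -/

section Adapted

variable {E E' : Type*} [NormedAddCommGroup E] [NormedSpace ℝ E] [FiniteDimensional ℝ E]
  [NormedAddCommGroup E'] [NormedSpace ℝ E'] [FiniteDimensional ℝ E']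
  {G : E' → E' →L[ℝ] E' →L[ℝ] ℝ} {F : E → E'} {y : E}

/-- The inner product of normal vectors in terms of an orthonormal basis of the normal space. -/
theorem IsImmersionAt.inner_eq_sum (h : IsImmersionAt G F y) {ι κ : Type*} [Fintype ι] [Fintype κ]
    [DecidableEq ι] [DecidableEq κ] {e : ι → E} {ξ : κ → E'}
    (he : ∀ i j, inducedMetric G F y (e i) (e j) = if i = j then 1 else 0)
    (hξ : ∀ r s, G (F y) (ξ r) (ξ s) = if r = s then 1 else 0)
    (hξn : ∀ r z, G (F y) (ξ r) (fderiv ℝ F y z) = 0)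
    (hcard : Fintype.card ι + Fintype.card κ = Module.finrank ℝ E') {a b : E'}
    (ha : ∀ z, G (F y) a (fderiv ℝ F y z) = 0) :
    G (F y) a b = ∑ r, G (F y) a (ξ r) * G (F y) b (ξ r) := by
  have hb : ∀ i j : ι ⊕ κ, G (F y) (Sum.elim (fun i => fderiv ℝ F y (e i)) ξ i)
      (Sum.elim (fun i => fderiv ℝ F y (e i)) ξ j) = if i = j then 1 else 0 := by
    rintro (i | r) (j | s)
    · simpa [inducedMetric_apply] using he i j
    · simpa using (h.metric.self.symm _ _).trans (hξn s (e i))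
    · simpa using hξn r (e j)
    · simpa using hξ r s
  have hexp := sum_apply_smul_of_orthonormal hb (by rw [Fintype.card_sum, hcard]) a
  conv_lhs => rw [← hexp]
  rw [Fintype.sum_sum_type]
  simp [ha, h.metric.self.symm _ b]

end Adapted

/-! ### Curvatures of the immersion in terms of shape matrices. -/

section Main

variable {n m : ℕ}
  {M : Type*} [TopologicalSpace M] [ChartedSpace (EuclideanSpace ℝ (Fin n)) M]
  [IsManifold (𝓡 n) ∞ M]
  {N : Type*} [TopologicalSpace N] [ChartedSpace (EuclideanSpace ℝ (Fin (n + m))) N]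
  [IsManifold (𝓡 (n + m)) ∞ N]
  {gM : Metric n M} {gN : Metric (n + m) N} {f : M → N}

/-- The matrix of the shape operator in the normal direction `η`. -/
noncomputable def shapeMatrix (gN : Metric (n + m) N) (f : M → N) (x : M)
    (e : Fin n → TangentSpace (𝓡 n) x) (η : TangentSpace (𝓡 (n + m)) (f x)) :
    Matrix (Fin n) (Fin n) ℝ :=
  Matrix.of fun i j => metricInChart gN (f x) (extChartAt (𝓡 (n + m)) (f x) (f x))
    (secondFundamentalForm gN f x (e i) (e j)) (coord (n + m) (f x) η)

theorem IsIsometricImmersion.shapeMatrix_transpose (hf : IsIsometricImmersion gM gN f) (x : M)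
    (e : Fin n → TangentSpace (𝓡 n) x) (η : TangentSpace (𝓡 (n + m)) (f x)) :
    (shapeMatrix gN f x e η).transpose = shapeMatrix gN f x e η := by
  ext i j
  exact congrArg (fun t => metricInChart gN (f x) (extChartAt (𝓡 (n + m)) (f x) (f x)) t
    (coord (n + m) (f x) η)) ((hf.isImmersionAt x).sff_symm _ _)

theorem IsIsometricImmersion.apply_fderiv_of_isNormal (hf : IsIsometricImmersion gM gN f) {x : M}
    {η : TangentSpace (𝓡 (n + m)) (f x)} (hη : IsNormal (n := n) gN f x η)
    (z : EuclideanSpace ℝ (Fin n)) :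
    metricInChart gN (f x) (extChartAt (𝓡 (n + m)) (f x) (f x)) (coord (n + m) (f x) η)
      (fderiv ℝ (writtenInExtChartAt (𝓡 n) (𝓡 (n + m)) x f) (extChartAt (𝓡 n) x x) z) = 0 := by
  obtain ⟨u, rfl⟩ := coord_surjective x z
  rw [fderiv_writtenInExtChartAt_coord hf.1, metricInChart_coord]
  exact hη u

theorem IsIsometricImmersion.inducedMetric_coord (hf : IsIsometricImmersion gM gN f) (x : M)
    (u v : TangentSpace (𝓡 n) x) :
    inducedMetric (metricInChart gN (f x)) (writtenInExtChartAt (𝓡 n) (𝓡 (n + m)) x f)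
      (extChartAt (𝓡 n) x x) (coord n x u) (coord n x v) = gM.inner x u v := by
  obtain ⟨h1, h2⟩ := (eventually_mem_charts hf.1 x).self_of_nhds
  rw [hf.inducedMetric_eq x h1 h2, metricInChart_coord]

theorem IsIsometricImmersion.inner_eq_sum_shape (hf : IsIsometricImmersion gM gN f) {x : M}
    {e : Fin n → TangentSpace (𝓡 n) x} (he : IsOrthonormal gM x e)
    {ξ : Fin m → TangentSpace (𝓡 (n + m)) (f x)} (hξ : IsOrthonormal gN (f x) ξ)
    (hξn : ∀ r, IsNormal (n := n) gN f x (ξ r)) {a : EuclideanSpace ℝ (Fin (n + m))}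
    (ha : ∀ z, metricInChart gN (f x) (extChartAt (𝓡 (n + m)) (f x) (f x)) a
      (fderiv ℝ (writtenInExtChartAt (𝓡 n) (𝓡 (n + m)) x f) (extChartAt (𝓡 n) x x) z) = 0)
    (b : EuclideanSpace ℝ (Fin (n + m))) :
    metricInChart gN (f x) (extChartAt (𝓡 (n + m)) (f x) (f x)) a b =
      ∑ r, metricInChart gN (f x) (extChartAt (𝓡 (n + m)) (f x) (f x)) a
          (coord (n + m) (f x) (ξ r)) *
        metricInChart gN (f x) (extChartAt (𝓡 (n + m)) (f x) (f x)) b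
          (coord (n + m) (f x) (ξ r)) := by
  have h := (hf.isImmersionAt x).inner_eq_sum (e := fun i => coord n x (e i))
    (ξ := fun r => coord (n + m) (f x) (ξ r)) (a := a) (b := b)
  rw [writtenInExtChartAt_self] at h
  exact h (fun i j => by rw [hf.inducedMetric_coord, he])
    (fun r s => by rw [metricInChart_coord, hξ])
    (fun r z => hf.apply_fderiv_of_isNormal (hξn r) z) (by simp) ha

theorem IsIsometricImmersion.riemannTensor_eq (hf : IsIsometricImmersion gM gN f) {κ : ℝ}
    (hN : HasConstantSectionalCurvature gN κ) {x : M}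
    {e : Fin n → TangentSpace (𝓡 n) x} (he : IsOrthonormal gM x e)
    {ξ : Fin m → TangentSpace (𝓡 (n + m)) (f x)} (hξ : IsOrthonormal gN (f x) ξ)
    (hξn : ∀ r, IsNormal (n := n) gN f x (ξ r)) {i j : Fin n} (hij : i ≠ j) :
    riemannTensor gM x (e i) (e j) (e j) (e i) =
      κ + ∑ r, (shapeMatrix gN f x e (ξ r) i i * shapeMatrix gN f x e (ξ r) j j -
        shapeMatrix gN f x e (ξ r) i j ^ 2) := by
  have hI := hf.isImmersionAt x
  have hcong : inducedMetric (metricInChart gN (f x))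
      (writtenInExtChartAt (𝓡 n) (𝓡 (n + m)) x f) =ᶠ[𝓝 (extChartAt (𝓡 n) x x)]
      metricInChart gM x :=
    (eventually_mem_charts hf.1 x).mono fun y hy => hf.inducedMetric_eq x hy.1 hy.2
  have hg := hI.gauss (coord n x (e i)) (coord n x (e j)) (coord n x (e j)) (coord n x (e i))
  rw [curvature_const hI.isMetricAt, curvatureAt_congr hcong, hcong.eq_of_nhds,
    ← SubmanifoldGeometry.riemannTensor_eq, hI.sff_symm (coord n x (e j)) (coord n x (e i))] at hg
  have hnorm := fun u w => hI.sff_normal u w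
  have hmet := hf.inducedMetric_coord x
  simp only [inducedMetric_apply] at hmet
  rw [writtenInExtChartAt_self] at hg hnorm hmet
  rw [hg, hN.curvatureAt_eq, hmet, hmet, hmet, hmet, he, he, he, he,
    hf.inner_eq_sum_shape he hξ hξn (hnorm _ _), hf.inner_eq_sum_shape he hξ hξn (hnorm _ _),
    Finset.sum_sub_distrib]
  simp only [hij, if_true, if_false, hij.symm]
  rw [add_sub_assoc]
  congr 1
  · ring
  · congr 1
    · exact Finset.sum_congr rfl fun r _ => mul_comm _ _
    · exact Finset.sum_congr rfl fun r _ => (sq _).symm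

theorem IsIsometricImmersion.normalCurvatureTensor_eq (hf : IsIsometricImmersion gM gN f) {κ : ℝ}
    (hN : HasConstantSectionalCurvature gN κ) {x : M}
    {e : Fin n → TangentSpace (𝓡 n) x} (he : IsOrthonormal gM x e)
    {ξ η : TangentSpace (𝓡 (n + m)) (f x)} (hξ : IsNormal (n := n) gN f x ξ)
    (hη : IsNormal (n := n) gN f x η) (i j : Fin n) :
    normalCurvatureTensor gN f x (e i) (e j) ξ η =
      matComm (shapeMatrix gN f x e η) (shapeMatrix gN f x e ξ) i j := by
  have hI := hf.isImmersionAt x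
  have hself := writtenInExtChartAt_self (n := n) (d := n + m) (f := f) x
  have hξ' := hf.apply_fderiv_of_isNormal hξ
  have hη' := hf.apply_fderiv_of_isNormal hη
  -- The normal extension of `ξ` used in the definition takes the value `ξ` at the base point.
  have hV0 := hI.normalPart_eq_self (w := coord (n + m) (f x) ξ) (by rw [hself]; exact hξ')
  have hr := hI.ricci (e := fun i => coord n x (e i))
    (fun i j => by rw [hf.inducedMetric_coord, he]) (by simp) (coord n x (e i)) (coord n x (e j))
    (hI.contDiffAt_normalPart (V := fun _ => coord (n + m) (f x) ξ) le_rfl contDiffAt_const)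
    (hI.eventually.mono fun z hz => hz.normalPart_apply_fderiv _) (η := coord (n + m) (f x) η)
    (fun z => by rw [hI.metric.self.symm, hself]; exact hη' z)
  have hsy := hI.metric.self.symm
  rw [hself] at hr hsy
  -- The ambient term vanishes: in constant curvature each of its summands contains the product of
  -- `ξ` with a tangent vector.
  rw [hV0, hN.curvatureAt_eq, hsy _ (coord (n + m) (f x) ξ), hξ',
    hsy _ (coord (n + m) (f x) ξ), hξ', zero_mul, zero_mul, sub_zero, mul_zero, zero_add] at hr
  refine hr.trans ?_
  have hsymm : ∀ ζ k l, shapeMatrix gN f x e ζ k l = shapeMatrix gN f x e ζ l k := fun ζ k l =>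
    congrFun (congrFun (hf.shapeMatrix_transpose x e ζ) l) k
  rw [matComm, Matrix.sub_apply, Matrix.mul_apply, Matrix.mul_apply]
  congr 1
  · refine Finset.sum_congr rfl fun k _ => ?_
    rw [hsymm ξ k j, mul_comm, hsy (coord (n + m) (f x) ξ)]
    rfl
  · refine Finset.sum_congr rfl fun k _ => ?_
    rw [hsymm η k j, hsy (coord (n + m) (f x) ξ)]
    rfl

theorem IsIsometricImmersion.meanCurvatureNormSq_eq (hf : IsIsometricImmersion gM gN f) {x : M}
    {e : Fin n → TangentSpace (𝓡 n) x} (he : IsOrthonormal gM x e)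
    {ξ : Fin m → TangentSpace (𝓡 (n + m)) (f x)} (hξ : IsOrthonormal gN (f x) ξ)
    (hξn : ∀ r, IsNormal (n := n) gN f x (ξ r)) :
    meanCurvatureNormSq gN f x e = ∑ r, ((shapeMatrix gN f x e (ξ r)).trace / n) ^ 2 := by
  have hH : ∀ w, metricInChart gN (f x) (extChartAt (𝓡 (n + m)) (f x) (f x))
      (meanCurvature gN f x e) w = (∑ i, metricInChart gN (f x)
        (extChartAt (𝓡 (n + m)) (f x) (f x)) (secondFundamentalForm gN f x (e i) (e i)) w) / n := by
    intro w
    simp [meanCurvature]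
    ring
  have hnorm := fun u w => (hf.isImmersionAt x).sff_normal u w
  rw [writtenInExtChartAt_self] at hnorm
  have hzero : ∀ i z, metricInChart gN (f x) (extChartAt (𝓡 (n + m)) (f x) (f x))
      (secondFundamentalForm gN f x (e i) (e i)) (fderiv ℝ
        (writtenInExtChartAt (𝓡 n) (𝓡 (n + m)) x f) (extChartAt (𝓡 n) x x) z) = 0 :=
    fun i z => hnorm (coord n x (e i)) (coord n x (e i)) z
  rw [meanCurvatureNormSq, hf.inner_eq_sum_shape he hξ hξn fun z => by
    rw [hH, Finset.sum_eq_zero fun i _ => hzero i z, zero_div]]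
  exact Finset.sum_congr rfl fun r _ => by rw [hH, ← sq]; rfl

end Main

end SubmanifoldGeometry

theorem mainTheorem2 {n m : ℕ} (hn : 2 ≤ n)
    {M : Type*} [TopologicalSpace M] [ChartedSpace (EuclideanSpace ℝ (Fin n)) M]
    [IsManifold (𝓡 n) ∞ M]
    {N : Type*} [TopologicalSpace N] [ChartedSpace (EuclideanSpace ℝ (Fin (n + m))) N]
    [IsManifold (𝓡 (n + m)) ∞ N]
    (gM : SubmanifoldGeometry.Metric n M) (gN : SubmanifoldGeometry.Metric (n + m) N)
    (c : ℝ) (hN : SubmanifoldGeometry.HasConstantSectionalCurvature gN c)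
    (f : M → N) (hf : SubmanifoldGeometry.IsIsometricImmersion gM gN f)
    (x : M)
    (e : Fin n → TangentSpace (𝓡 n) x) (he : SubmanifoldGeometry.IsOrthonormal gM x e)
    (ξ : Fin m → TangentSpace (𝓡 (n + m)) (f x))
    (hξ : SubmanifoldGeometry.IsOrthonormal gN (f x) ξ)
    (hξn : ∀ r, SubmanifoldGeometry.IsNormal (n := n) gN f x (ξ r)) :
    SubmanifoldGeometry.normalizedScalarCurvature gM x e
        + SubmanifoldGeometry.normalScalarCurvature gN f x e ξ
      ≤ SubmanifoldGeometry.meanCurvatureNormSq gN f x e + c := by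
  have h := SubmanifoldGeometry.algebraic_normal_scalar_curvature_inequality hn c
    (fun r => SubmanifoldGeometry.shapeMatrix gN f x e (ξ r))
    fun r => hf.shapeMatrix_transpose x e (ξ r)
  rw [hf.meanCurvatureNormSq_eq he hξ hξn]
  refine le_trans (le_of_eq ?_) h
  rw [SubmanifoldGeometry.normalizedScalarCurvature, SubmanifoldGeometry.normalScalarCurvature]
  congr 2
  · exact Finset.sum_congr rfl fun i _ => Finset.sum_congr rfl fun j hj =>
      hf.riemannTensor_eq hN he hξ hξn (Finset.mem_Ioi.1 hj).ne
  · congr 1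
    exact Finset.sum_congr rfl fun i _ => Finset.sum_congr rfl fun j _ =>
      Finset.sum_congr rfl fun r _ => Finset.sum_congr rfl fun s _ => by
        rw [hf.normalCurvatureTensor_eq hN he (hξn r) (hξn s)]
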